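/- For $n\ge 1$ let $\mathbf{B}_n$ be the braid group with Artin generators $\sigma_1,\dots,\sigma_{n-1}$ (relations $\sigma_i\sigma_j=\sigma_j\sigma_i$ for $|i-j|\ge 2$ and $\sigma_i\sigma_{i+1}\sigma_i=\sigma_{i+1}\sigma_i\sigma_{i+1}$), let $\mathrm{id}_1\natural - :\mathbf{B}_n\hookrightarrow\mathbf{B}_{n+1}$ be the injection $\sigma_i\mapsto\sigma_{i+1}$, and let $\mathbf{F}_n$ be the free group on $x_1,\dots,x_n$. Put $R=\mathbb{Z}[t^{\pm1},q^{\pm1}]$ and consider the following representations over $R$. - For a unit $u\in R$, $\mathrm{Bur}_{n,u}:\mathbf{B}_n\to GL_n(R)$ is the unreduced Burau representation $\sigma_i\mapsto I_{i-1}\oplus\begin{pmatrix}0&u\\1&1-u\end{pmatrix}\oplus I_{n-i-1}$. - $\mathrm{TYM}_n:\mathbf{B}_n\to GL_n(R)$ is the Tong–Yang–Ma representation $\sigma_i\mapsto I_{i-1}\oplus\begin{pmatrix}0&1\\t&0\end{pmatrix}\oplus I_{n-i-1}$. - For a representation $\rho$ of $\mathbf{B}_{n+1}$ on an $R$-module $V$,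 the Long–Moody construction $\mathbf{LM}(\rho)$ is the representation of $\mathbf{B}_n$ on $\mathcal{I}\otimes_{\mathbb{Z}[\mathbf{F}_n]}V$ given by $\mathbf{LM}(\rho)(\lambda)(i\otimes v)=a_n(\lambda)(i)\otimes\rho(\mathrm{id}_1\natural\lambda)(v)$. Here $\mathcal{I}$ is the augmentation ideal of $\mathbb{Z}[\mathbf{F}_n]$. The group $\mathbf{F}_n$ acts on $V$ through $\rho\circ\chi_n$, where $\chi_n:\mathbf{F}_n\to\mathbf{B}_{n+1}$, $\chi_n(x_i)=(\sigma_{i-1}\cdots\sigma_1)^{-1}\sigma_i^2(\sigma_{i-1}\cdots\sigma_1)$. The homomorphism $a_n:\mathbf{B}_n\to\mathrm{Aut}(\mathbf{F}_n)$ is given by $a_n(\sigma_i)(x_i)=x_{i+1}$, $a_n(\sigma_i)(x_{i+1})=x_{i+1}^{-1}x_ix_{i+1}$ and $a_n(\sigma_i)(x_j)=x_j$ for $j\ne i,i+1$. - For a unit $u\in R$ let $R_u$ be the rank-one representation in which every Artin generator acts as multiplication by $u$. Then $\mathbf{LM}_q(\mathrm{TYM}_{n+1})=R_{q^{-1}}\otimes_R\mathbf{LM}(R_q\otimes_R\mathrm{TYM}_{n+1})$,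 a representation of $\mathbf{B}_n$. Moreover, $\tau_1\mathbf{LM}_q(\mathrm{TYM}_{n+1})$ is the representation $\mathbf{LM}_q(\mathrm{TYM}_{n+2})$ of $\mathbf{B}_{n+1}$ restricted to $\mathbf{B}_n$ along $\mathrm{id}_1\natural-$. **Claim.** For every $n\ge 3$, $$\ker\big(\tau_1\mathbf{LM}_q(\mathrm{TYM}_{n+1})\big)\subseteq\ker(\mathrm{Bur}_{n,q^2}),$$ and for every $n\ge 5$ this inclusion is strict. Moreover, write $[a,b]=a^{-1}b^{-1}ab$ and consider the following braids. - In $\mathbf{B}_5$: $\sigma=[\psi_1^{-1}\sigma_4\psi_1,\ \psi_2^{-1}\sigma_4\sigma_3\sigma_2\sigma_1^2\sigma_2\sigma_3\sigma_4\psi_2]$, with $\psi_1=\sigma_3^{-1}\sigma_2\sigma_1^2\sigma_2\sigma_4^3\sigma_3\sigma_2$ and $\psi_2=\sigma_4^{-1}\sigma_3\sigma_2\sigma_1^{-2}\sigma_2\sigma_1^2\sigma_2^2\sigma_1\sigma_4^5$. - In $\mathbf{B}_6$: $\tau=[\delta_1^{-1}\sigma_3\delta_1,\ \delta_2^{-1}\sigma_3\delta_2]$,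 with $\delta_1=\sigma_4\sigma_5^{-1}\sigma_2^{-1}\sigma_1$ and $\delta_2=\sigma_4^{-1}\sigma_5^2\sigma_2\sigma_1^{-2}$. - In $\mathbf{B}_6$: $\xi=[\theta^{-1}\sigma_5\theta,\ (\sigma_2\sigma_3\sigma_4\sigma_5)^5]$, with $\theta=\sigma_5^{-1}\sigma_4^{-1}\sigma_5\sigma_3^{-1}\sigma_4\sigma_2^{-1}\sigma_3^{-3}\sigma_1^3\sigma_5\sigma_4\sigma_3^{-1}\sigma_2^{-1}\sigma_1$. - In $\mathbf{B}_7$: $\nu=[\sigma_1,\ \theta'^{-1}\sigma_6\theta']$, with $\theta'=\mathrm{id}_1\natural\theta$. Each of $\sigma,\tau,\xi,\nu$ is nontrivial and lies in $\ker(\mathrm{Bur}_{n,q^2})$ but not in $\ker(\tau_1\mathbf{LM}_q(\mathrm{TYM}_{n+1}))$, where $n=5,6,6,7$ respectively. -/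

import Mathlib

open scoped TensorProduct

noncomputable section

/-! ### Braid groups -/

/-- The relators of the Artin presentation; the generators `σ_1, …, σ_{n-1}` are indexed, with a
shift by one, by `Fin (n - 1)`. -/
inductive BraidRel (n : ℕ) : FreeGroup (Fin (n - 1)) → Prop
  | comm (i j : Fin (n - 1)) (h : i.val + 2 ≤ j.val) :
      BraidRel n (FreeGroup.of i * FreeGroup.of j * (FreeGroup.of j * FreeGroup.of i)⁻¹)
  | braid (i j : Fin (n - 1)) (h : i.val + 1 = j.val) :
      BraidRel n (FreeGroup.of i * FreeGroup.of j * FreeGroup.of i *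
        (FreeGroup.of j * FreeGroup.of i * FreeGroup.of j)⁻¹)

/-- The braid group `B_n` on `n` strands, by its Artin presentation. -/
abbrev BraidGroup (n : ℕ) : Type := PresentedGroup {r | BraidRel n r}

namespace BraidGroup

/-- The Artin generator `σ_{i+1}` for `i : Fin (n - 1)`. -/
def gen {n : ℕ} (i : Fin (n - 1)) : BraidGroup n := PresentedGroup.of i

/-- The Artin generator `σ_i` for `1 ≤ i ≤ n - 1` (and `1` for all other `i`). -/
def σ (n i : ℕ) : BraidGroup n := if h : i - 1 < n - 1 ∧ 1 ≤ i then gen ⟨i - 1, h.1⟩ else 1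

/-- A homomorphism out of `B_n` from elements that satisfy the Artin relations. -/
def lift {n : ℕ} {G : Type*} [Group G] (f : Fin (n - 1) → G)
    (hc : ∀ i j : Fin (n - 1), i.val + 2 ≤ j.val → f i * f j = f j * f i)
    (hb : ∀ i j : Fin (n - 1), i.val + 1 = j.val → f i * f j * f i = f j * f i * f j) :
    BraidGroup n →* G :=
  PresentedGroup.toGroup (f := f) (by
    rintro r (⟨i, j, h⟩ | ⟨i, j, h⟩)
    · simp only [map_mul, map_inv, FreeGroup.lift_apply_of]
      exact mul_inv_eq_one.2 (hc i j h)
    · simp only [map_mul, map_inv, FreeGroup.lift_apply_of]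
      exact mul_inv_eq_one.2 (hb i j h))

theorem lift_gen {n : ℕ} {G : Type*} [Group G] (f : Fin (n - 1) → G) (hc hb) (i : Fin (n - 1)) :
    lift f hc hb (gen i) = f i := PresentedGroup.toGroup.of _

theorem gen_comm {n : ℕ} (i j : Fin (n - 1)) (h : i.val + 2 ≤ j.val) :
    gen i * gen j = gen j * gen i := by
  have := PresentedGroup.one_of_mem (rels := {r | BraidRel n r}) (BraidRel.comm i j h)
  simp only [map_mul, map_inv] at this
  exact mul_inv_eq_one.1 this

theorem gen_braid {n : ℕ} (i j : Fin (n - 1)) (h : i.val + 1 = j.val) :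
    gen i * gen j * gen i = gen j * gen i * gen j := by
  have := PresentedGroup.one_of_mem (rels := {r | BraidRel n r}) (BraidRel.braid i j h)
  simp only [map_mul, map_inv] at this
  exact mul_inv_eq_one.1 this

theorem induction_gen {n : ℕ} {p : BraidGroup n → Prop} (x : BraidGroup n)
    (hg : ∀ i, p (gen i)) (h1 : p 1) (hm : ∀ x y, p x → p y → p (x * y))
    (hi : ∀ x, p x → p x⁻¹) : p x := by
  obtain ⟨w, rfl⟩ := PresentedGroup.mk_surjective _ x
  induction w with
  | C1 => simpa using h1
  | of i => exact hg i
  | inv_of i ih => rw [map_inv]; exact hi _ ih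
  | mul a b ha hb => rw [map_mul]; exact hm _ _ ha hb

theorem σ_eq {n i : ℕ} (h : i < n - 1) : σ n (i + 1) = gen ⟨i, h⟩ := by
  simp [σ, h]

theorem σ_comm {n i j : ℕ} (hi : 1 ≤ i) (hj : i + 2 ≤ j) : σ n i * σ n j = σ n j * σ n i := by
  unfold σ
  split_ifs
  · apply gen_comm; simp only; omega
  all_goals simp

theorem σ_braid {n i : ℕ} (hi : 1 ≤ i) (hn : i + 1 < n) :
    σ n i * σ n (i + 1) * σ n i = σ n (i + 1) * σ n i * σ n (i + 1) := by
  unfold σ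
  rw [dif_pos ⟨by omega, by omega⟩, dif_pos ⟨by omega, by omega⟩]
  apply gen_braid; simp only; omega

/-- The injection `id_1 ♮ - : B_n → B_{n+1}` with `σ_i ↦ σ_{i+1}`. -/
def shift (n : ℕ) : BraidGroup n →* BraidGroup (n + 1) :=
  lift (fun i => σ (n + 1) (i.val + 2))
    (fun i j h => σ_comm (by omega) (by omega))
    (fun i j h => by
      have : j.val + 2 = i.val + 2 + 1 := by omega
      simp only [this]
      exact σ_braid (by omega) (by omega))

/-- The homomorphism from `B_n` to an abelian group that sends every Artin generator to `u`. -/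
def const (n : ℕ) {A : Type*} [CommGroup A] (u : A) : BraidGroup n →* A :=
  lift (fun _ => u) (fun _ _ _ => rfl) (fun _ _ _ => rfl)

/-- The commutator `a⁻¹ b⁻¹ a b`. -/
def comm {G : Type*} [Group G] (a b : G) : G := a⁻¹ * b⁻¹ * a * b

end BraidGroup

/-! ### The Burau and the Tong-Yang-Ma representations -/

section Block

variable {R : Type*} [CommRing R] {n : ℕ}

/-- The endomorphism of `R^n` (column vectors) with the matrix `I_i ⊕ T ⊕ I_{n-i-2}`, where `T` is
a `2 × 2` matrix and `i : Fin (n - 1)` (counted from `0`). -/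
def blockMap (i : Fin (n - 1)) (T : Matrix (Fin 2) (Fin 2) R) : (Fin n → R) →ₗ[R] (Fin n → R) where
  toFun v k :=
    if k.val = i.val then T 0 0 * v ⟨i, by omega⟩ + T 0 1 * v ⟨i + 1, by omega⟩
    else if k.val = i.val + 1 then T 1 0 * v ⟨i, by omega⟩ + T 1 1 * v ⟨i + 1, by omega⟩
    else v k
  map_add' v w := by
    funext k
    simp only [Pi.add_apply]
    split_ifs <;> ring
  map_smul' c v := by
    funext k
    simp only [Pi.smul_apply, smul_eq_mul, RingHom.id_apply]
    split_ifs <;> ring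

theorem blockMap_apply (i : Fin (n - 1)) (T : Matrix (Fin 2) (Fin 2) R) (v : Fin n → R)
    (k : Fin n) : blockMap i T v k =
    if k.val = i.val then T 0 0 * v ⟨i, by omega⟩ + T 0 1 * v ⟨i + 1, by omega⟩
    else if k.val = i.val + 1 then T 1 0 * v ⟨i, by omega⟩ + T 1 1 * v ⟨i + 1, by omega⟩
    else v k := rfl

theorem blockMap_one (i : Fin (n - 1)) : blockMap i (1 : Matrix (Fin 2) (Fin 2) R) = 1 := by
  refine LinearMap.ext fun v => funext fun k => ?_
  simp only [Module.End.one_apply, blockMap_apply]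
  split_ifs with h1 h2
  · simp [← h1]
  · simp [← h2]
  · rfl

theorem blockMap_fst (i : Fin (n - 1)) (T : Matrix (Fin 2) (Fin 2) R) (v : Fin n → R)
    (h : i.val < n) : blockMap i T v ⟨i, h⟩ =
      T 0 0 * v ⟨i, by omega⟩ + T 0 1 * v ⟨i + 1, by omega⟩ := by
  simp [blockMap_apply]

theorem blockMap_snd (i : Fin (n - 1)) (T : Matrix (Fin 2) (Fin 2) R) (v : Fin n → R)
    (h : i.val + 1 < n) : blockMap i T v ⟨i + 1, h⟩ =
      T 1 0 * v ⟨i, by omega⟩ + T 1 1 * v ⟨i + 1, by omega⟩ := by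
  simp [blockMap_apply]

theorem blockMap_other (i : Fin (n - 1)) (T : Matrix (Fin 2) (Fin 2) R) (v : Fin n → R)
    (k : Fin n) (h1 : k.val ≠ i.val) (h2 : k.val ≠ i.val + 1) : blockMap i T v k = v k := by
  simp [blockMap_apply, h1, h2]

theorem blockMap_mul (i : Fin (n - 1)) (S T : Matrix (Fin 2) (Fin 2) R) :
    blockMap i (S * T) = blockMap i S * blockMap i T := by
  refine LinearMap.ext fun v => funext fun ⟨k, hk⟩ => ?_
  rw [Module.End.mul_apply]
  by_cases h1 : k = i.val
  · subst h1
    simp only [blockMap_fst, blockMap_snd, Matrix.mul_apply, Fin.sum_univ_two]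
    ring
  by_cases h2 : k = i.val + 1
  · subst h2
    simp only [blockMap_fst, blockMap_snd, Matrix.mul_apply, Fin.sum_univ_two]
    ring
  rw [blockMap_other _ _ _ _ h1 h2, blockMap_other _ _ _ _ h1 h2, blockMap_other _ _ _ _ h1 h2]

theorem blockMap_comm (i j : Fin (n - 1)) (h : i.val + 2 ≤ j.val)
    (S T : Matrix (Fin 2) (Fin 2) R) :
    blockMap i S * blockMap j T = blockMap j T * blockMap i S := by
  refine LinearMap.ext fun v => funext fun ⟨k, hk⟩ => ?_
  rw [Module.End.mul_apply, Module.End.mul_apply]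
  have o1 : ∀ (w : Fin n → R) (h' : i.val < n), blockMap j T w ⟨i, h'⟩ = w ⟨i, h'⟩ := fun w h' =>
    blockMap_other _ _ _ _ (by simp only; omega) (by simp only; omega)
  have o2 : ∀ (w : Fin n → R) (h' : i.val + 1 < n),
      blockMap j T w ⟨i + 1, h'⟩ = w ⟨i + 1, h'⟩ := fun w h' =>
    blockMap_other _ _ _ _ (by simp only; omega) (by simp only; omega)
  have o3 : ∀ (w : Fin n → R) (h' : j.val < n), blockMap i S w ⟨j, h'⟩ = w ⟨j, h'⟩ := fun w h' =>
    blockMap_other _ _ _ _ (by simp only; omega) (by simp only; omega)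
  have o4 : ∀ (w : Fin n → R) (h' : j.val + 1 < n),
      blockMap i S w ⟨j + 1, h'⟩ = w ⟨j + 1, h'⟩ := fun w h' =>
    blockMap_other _ _ _ _ (by simp only; omega) (by simp only; omega)
  by_cases h1 : k = i.val
  · subst h1; simp only [blockMap_fst, o1, o2]
  by_cases h2 : k = i.val + 1
  · subst h2; simp only [blockMap_snd, o1, o2]
  by_cases h3 : k = j.val
  · subst h3; simp only [blockMap_fst, o3, o4]
  by_cases h4 : k = j.val + 1
  · subst h4; simp only [blockMap_snd, o3, o4]
  rw [blockMap_other _ _ _ _ h1 h2, blockMap_other _ _ _ _ h3 h4, blockMap_other _ _ _ _ h3 h4,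
    blockMap_other _ _ _ _ h1 h2]

/-- `T ↦ I_i ⊕ T ⊕ I_{n-i-2}` on invertible `2 × 2` matrices. -/
def blockUnit (i : Fin (n - 1)) : (Matrix (Fin 2) (Fin 2) R)ˣ →* ((Fin n → R) →ₗ[R] (Fin n → R))ˣ :=
  Units.map
    { toFun := blockMap i
      map_one' := blockMap_one i
      map_mul' := blockMap_mul i }

theorem blockUnit_val (i : Fin (n - 1)) (T : (Matrix (Fin 2) (Fin 2) R)ˣ) :
    (blockUnit i T).val = blockMap i T.val := rfl

theorem blockUnit_comm (i j : Fin (n - 1)) (h : i.val + 2 ≤ j.val)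
    (S T : (Matrix (Fin 2) (Fin 2) R)ˣ) :
    blockUnit i S * blockUnit j T = blockUnit j T * blockUnit i S :=
  Units.ext (blockMap_comm i j h _ _)

/-- The invertible matrix `(0, u; 1, 1 - u)`. -/
def burauMatrix (u : Rˣ) : (Matrix (Fin 2) (Fin 2) R)ˣ where
  val := !![0, (u : R); 1, 1 - (u : R)]
  inv := !![1 - ((u⁻¹ : Rˣ) : R), 1; ((u⁻¹ : Rˣ) : R), 0]
  val_inv := by
    ext a b; fin_cases a <;> fin_cases b <;> simp [Matrix.mul_apply, sub_mul]
  inv_val := by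
    ext a b; fin_cases a <;> fin_cases b <;> simp [Matrix.mul_apply, sub_mul, mul_sub]

/-- The invertible matrix `(0, 1; u, 0)`. -/
def tymMatrix (u : Rˣ) : (Matrix (Fin 2) (Fin 2) R)ˣ where
  val := !![0, 1; (u : R), 0]
  inv := !![0, ((u⁻¹ : Rˣ) : R); 1, 0]
  val_inv := by
    ext a b; fin_cases a <;> fin_cases b <;> simp [Matrix.mul_apply]
  inv_val := by
    ext a b; fin_cases a <;> fin_cases b <;> simp [Matrix.mul_apply]

/-- The unreduced Burau representation `Bur_{n,u}` of `B_n` on `R^n`,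
`σ_{i+1} ↦ I_i ⊕ (0, u; 1, 1 - u) ⊕ I_{n-i-2}`. -/
def burau (n : ℕ) (u : Rˣ) : Representation R (BraidGroup n) (Fin n → R) :=
  (Units.coeHom _).comp (BraidGroup.lift (fun i => blockUnit i (burauMatrix u))
    (fun i j h => blockUnit_comm i j h _ _)
    (fun i j h => by
      refine Units.ext (LinearMap.ext fun v => funext fun k => ?_)
      simp only [Units.val_mul, Module.End.mul_apply, blockUnit_val, blockMap_apply, burauMatrix,
        Matrix.of_apply, Matrix.cons_val', Matrix.cons_val_zero, Matrix.cons_val_one,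
        Matrix.cons_val_fin_one]
      have hj : j.val = i.val + 1 := h.symm
      simp only [hj]
      split_ifs <;> first | omega | ring))

/-- The Tong-Yang-Ma representation `TYM_n` of `B_n` on `R^n` with parameter `u`,
`σ_{i+1} ↦ I_i ⊕ (0, 1; u, 0) ⊕ I_{n-i-2}`. -/
def tongYangMa (n : ℕ) (u : Rˣ) : Representation R (BraidGroup n) (Fin n → R) :=
  (Units.coeHom _).comp (BraidGroup.lift (fun i => blockUnit i (tymMatrix u))
    (fun i j h => blockUnit_comm i j h _ _)
    (fun i j h => by
      refine Units.ext (LinearMap.ext fun v => funext fun k => ?_)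
      simp only [Units.val_mul, Module.End.mul_apply, blockUnit_val, blockMap_apply, tymMatrix,
        Matrix.of_apply, Matrix.cons_val', Matrix.cons_val_zero, Matrix.cons_val_one,
        Matrix.cons_val_fin_one]
      have hj : j.val = i.val + 1 := h.symm
      simp only [hj]
      split_ifs <;> first | omega | ring))

end Block

/-! ### The Artin action on free groups and the embedding `F_n → B_{n+1}` -/

namespace BraidGroup

/-- The values of `a_n(σ_{i+1})` on the free generators (counted from `0`):
`x_i ↦ x_{i+1}`, `x_{i+1} ↦ x_{i+1}⁻¹ x_i x_{i+1}`, and `x_j ↦ x_j` otherwise. -/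
def artinFun {n : ℕ} (i : Fin (n - 1)) (j : Fin n) : FreeGroup (Fin n) :=
  let a : FreeGroup (Fin n) := FreeGroup.of ⟨i.val, by omega⟩
  let b : FreeGroup (Fin n) := FreeGroup.of ⟨i.val + 1, by omega⟩
  if j.val = i.val then b else if j.val = i.val + 1 then b⁻¹ * a * b else FreeGroup.of j

/-- The values of the inverse of `a_n(σ_{i+1})` on the free generators. -/
def artinInvFun {n : ℕ} (i : Fin (n - 1)) (j : Fin n) : FreeGroup (Fin n) :=
  let a : FreeGroup (Fin n) := FreeGroup.of ⟨i.val, by omega⟩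
  let b : FreeGroup (Fin n) := FreeGroup.of ⟨i.val + 1, by omega⟩
  if j.val = i.val then a * b * a⁻¹ else if j.val = i.val + 1 then a else FreeGroup.of j

theorem artinFun_fst {n : ℕ} (i : Fin (n - 1)) (h : i.val < n) :
    artinFun i ⟨i, h⟩ = FreeGroup.of ⟨i.val + 1, by omega⟩ := by
  simp [artinFun]

theorem artinFun_snd {n : ℕ} (i : Fin (n - 1)) (h : i.val + 1 < n) :
    artinFun i ⟨i + 1, h⟩ = (FreeGroup.of ⟨i.val + 1, h⟩)⁻¹ * FreeGroup.of ⟨i.val, by omega⟩ *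
      FreeGroup.of ⟨i.val + 1, h⟩ := by
  simp [artinFun]

theorem artinFun_other {n : ℕ} (i : Fin (n - 1)) (j : Fin n) (h1 : j.val ≠ i.val)
    (h2 : j.val ≠ i.val + 1) : artinFun i j = FreeGroup.of j := by
  simp [artinFun, h1, h2]

theorem artinInvFun_fst {n : ℕ} (i : Fin (n - 1)) (h : i.val < n) :
    artinInvFun i ⟨i, h⟩ = FreeGroup.of ⟨i.val, h⟩ * FreeGroup.of ⟨i.val + 1, by omega⟩ *
      (FreeGroup.of ⟨i.val, h⟩)⁻¹ := by
  simp [artinInvFun]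

theorem artinInvFun_snd {n : ℕ} (i : Fin (n - 1)) (h : i.val + 1 < n) :
    artinInvFun i ⟨i + 1, h⟩ = FreeGroup.of ⟨i.val, by omega⟩ := by
  simp [artinInvFun]

theorem artinInvFun_other {n : ℕ} (i : Fin (n - 1)) (j : Fin n) (h1 : j.val ≠ i.val)
    (h2 : j.val ≠ i.val + 1) : artinInvFun i j = FreeGroup.of j := by
  simp [artinInvFun, h1, h2]

/-- The automorphism `a_n(σ_{i+1})` of the free group `F_n`. -/
def artinGen {n : ℕ} (i : Fin (n - 1)) : MulAut (FreeGroup (Fin n)) :=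
  MonoidHom.toMulEquiv (FreeGroup.lift (artinFun i)) (FreeGroup.lift (artinInvFun i))
    (by
      refine FreeGroup.ext_hom _ _ fun ⟨j, hj⟩ => ?_
      simp only [MonoidHom.comp_apply, FreeGroup.lift_apply_of, MonoidHom.id_apply]
      by_cases h1 : j = i.val
      · subst h1
        simp only [artinFun_fst, FreeGroup.lift_apply_of, artinInvFun_snd]
      by_cases h2 : j = i.val + 1
      · subst h2
        simp only [artinFun_snd, map_mul, map_inv, FreeGroup.lift_apply_of, artinInvFun_snd,
          artinInvFun_fst]
        group
      rw [artinFun_other _ _ h1 h2, FreeGroup.lift_apply_of, artinInvFun_other _ _ h1 h2])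
    (by
      refine FreeGroup.ext_hom _ _ fun ⟨j, hj⟩ => ?_
      simp only [MonoidHom.comp_apply, FreeGroup.lift_apply_of, MonoidHom.id_apply]
      by_cases h1 : j = i.val
      · subst h1
        simp only [artinInvFun_fst, map_mul, map_inv, FreeGroup.lift_apply_of, artinFun_snd,
          artinFun_fst]
        group
      by_cases h2 : j = i.val + 1
      · subst h2
        simp only [artinInvFun_snd, FreeGroup.lift_apply_of, artinFun_fst]
      rw [artinInvFun_other _ _ h1 h2, FreeGroup.lift_apply_of, artinFun_other _ _ h1 h2])

theorem artinGen_of {n : ℕ} (i : Fin (n - 1)) (j : Fin n) :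
    artinGen i (FreeGroup.of j) = artinFun i j :=
  FreeGroup.lift_apply_of

theorem mulAut_ext {n : ℕ} {f g : MulAut (FreeGroup (Fin n))}
    (h : ∀ j, f (FreeGroup.of j) = g (FreeGroup.of j)) : f = g := by
  have : f.toMonoidHom = g.toMonoidHom := FreeGroup.ext_hom _ _ h
  exact MulEquiv.ext fun x => DFunLike.congr_fun this x

theorem artinGen_comm {n : ℕ} (i j : Fin (n - 1)) (h : i.val + 2 ≤ j.val) :
    artinGen i * artinGen j = artinGen j * artinGen i := by
  have o1 : ∀ h', artinFun j ⟨i.val, h'⟩ = FreeGroup.of ⟨i.val, h'⟩ := fun h' =>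
    artinFun_other _ _ (by simp only; omega) (by simp only; omega)
  have o2 : ∀ h', artinFun j ⟨i.val + 1, h'⟩ = FreeGroup.of ⟨i.val + 1, h'⟩ := fun h' =>
    artinFun_other _ _ (by simp only; omega) (by simp only; omega)
  have o3 : ∀ h', artinFun i ⟨j.val, h'⟩ = FreeGroup.of ⟨j.val, h'⟩ := fun h' =>
    artinFun_other _ _ (by simp only; omega) (by simp only; omega)
  have o4 : ∀ h', artinFun i ⟨j.val + 1, h'⟩ = FreeGroup.of ⟨j.val + 1, h'⟩ := fun h' =>
    artinFun_other _ _ (by simp only; omega) (by simp only; omega)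
  refine mulAut_ext fun ⟨k, hk⟩ => ?_
  simp only [MulAut.mul_apply, artinGen_of]
  by_cases h1 : k = i.val
  · subst h1; simp only [o1, artinFun_fst, artinGen_of, o2]
  by_cases h2 : k = i.val + 1
  · subst h2; simp only [o1, artinFun_snd, artinGen_of, o2, map_mul, map_inv]
  by_cases h3 : k = j.val
  · subst h3; simp only [o3, artinFun_fst, artinGen_of, o4]
  by_cases h4 : k = j.val + 1
  · subst h4; simp only [o3, artinFun_snd, artinGen_of, o4, map_mul, map_inv]
  have e1 : artinFun i ⟨k, hk⟩ = FreeGroup.of ⟨k, hk⟩ := artinFun_other _ _ h1 h2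
  have e2 : artinFun j ⟨k, hk⟩ = FreeGroup.of ⟨k, hk⟩ := artinFun_other _ _ h3 h4
  simp only [e1, e2, artinGen_of]

theorem artinGen_braid {n : ℕ} (i j : Fin (n - 1)) (h : i.val + 1 = j.val) :
    artinGen i * artinGen j * artinGen i = artinGen j * artinGen i * artinGen j := by
  obtain ⟨i, hi⟩ := i
  obtain ⟨j, hj⟩ := j
  obtain rfl : j = i + 1 := h.symm
  have a1 := fun h' => artinFun_fst (n := n) ⟨i, hi⟩ h'
  have a2 := fun h' => artinFun_snd (n := n) ⟨i, hi⟩ h'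
  have a3 : ∀ h', artinFun (n := n) ⟨i, hi⟩ ⟨i + 1 + 1, h'⟩ = FreeGroup.of ⟨i + 1 + 1, h'⟩ :=
    fun h' => artinFun_other _ _ (by simp only; omega) (by simp only; omega)
  have b1 : ∀ h', artinFun (n := n) ⟨i + 1, hj⟩ ⟨i, h'⟩ = FreeGroup.of ⟨i, h'⟩ :=
    fun h' => artinFun_other _ _ (by simp only; omega) (by simp only; omega)
  have b2 := fun h' => artinFun_fst (n := n) ⟨i + 1, hj⟩ h'
  have b3 := fun h' => artinFun_snd (n := n) ⟨i + 1, hj⟩ h'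
  simp only at a1 a2 b2 b3
  refine mulAut_ext fun ⟨k, hk⟩ => ?_
  simp only [MulAut.mul_apply, artinGen_of]
  by_cases h1 : k = i
  · subst h1; simp only [a1, a3, b1, b2, artinGen_of]
  by_cases h2 : k = i + 1
  · subst h2; simp only [a1, a2, a3, b1, b2, b3, artinGen_of, map_mul, map_inv]
  by_cases h3 : k = i + 1 + 1
  · subst h3; simp only [a2, a3, b1, b2, b3, artinGen_of, map_mul, map_inv]; group
  have e1 : artinFun (n := n) ⟨i, hi⟩ ⟨k, hk⟩ = FreeGroup.of ⟨k, hk⟩ := artinFun_other _ _ h1 h2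
  have e2 : artinFun (n := n) ⟨i + 1, hj⟩ ⟨k, hk⟩ = FreeGroup.of ⟨k, hk⟩ :=
    artinFun_other _ _ h2 h3
  simp only [e1, e2, artinGen_of]

/-- The Artin homomorphism `a_n : B_n → Aut(F_n)`. -/
def artin (n : ℕ) : BraidGroup n →* MulAut (FreeGroup (Fin n)) :=
  lift artinGen artinGen_comm artinGen_braid

/-- The braid `σ_k ⋯ σ_2 σ_1` in `B_n`. -/
def descend (n : ℕ) : ℕ → BraidGroup n
  | 0 => 1
  | k + 1 => σ n (k + 1) * descend n k

/-- The homomorphism `χ_n : F_n → B_{n+1}` with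
`x_i ↦ (σ_{i-1} ⋯ σ_2 σ_1)⁻¹ σ_i² (σ_{i-1} ⋯ σ_2 σ_1)` (here `j = i - 1`). -/
def chi (n : ℕ) : FreeGroup (Fin n) →* BraidGroup (n + 1) :=
  FreeGroup.lift fun j =>
    (descend (n + 1) j.val)⁻¹ * σ (n + 1) (j.val + 1) ^ 2 * descend (n + 1) j.val

theorem σ_descend_comm {n k i : ℕ} (h : k + 2 ≤ i) :
    σ n i * descend n k = descend n k * σ n i := by
  induction k with
  | zero => simp [descend]
  | succ k ih =>
    rw [descend, ← mul_assoc, ← σ_comm (by omega) (by omega : k + 1 + 2 ≤ i), mul_assoc,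
      ih (by omega), mul_assoc]

theorem descend_σ {n k i : ℕ} (h : i + 2 ≤ k) (hk : k < n) :
    descend n k * σ n (i + 2) = σ n (i + 1) * descend n k := by
  induction k, h using Nat.le_induction with
  | base =>
    have hb := σ_braid (n := n) (i := i + 1) (by omega) (by omega)
    have e : descend n (i + 2) = σ n (i + 2) * (σ n (i + 1) * descend n i) := rfl
    rw [e]
    calc _ = σ n (i + 2) * σ n (i + 1) * (descend n i * σ n (i + 2)) := by group
      _ = σ n (i + 2) * σ n (i + 1) * σ n (i + 2) * descend n i := by
        rw [← σ_descend_comm (by omega)]; group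
      _ = _ := by rw [← hb]; group
  | succ k hk' ih =>
    rw [descend, mul_assoc, ih (by omega), ← mul_assoc, ← σ_comm (by omega) (by omega), mul_assoc]

theorem chi_of {n : ℕ} (j : ℕ) (h : j < n) : chi n (FreeGroup.of ⟨j, h⟩) =
    (descend (n + 1) j)⁻¹ * σ (n + 1) (j + 1) ^ 2 * descend (n + 1) j :=
  FreeGroup.lift_apply_of

theorem σ_chi_other {n i j : ℕ} (h : j < n) (h1 : j ≠ i) (h2 : j ≠ i + 1) :
    σ (n + 1) (i + 2) * chi n (FreeGroup.of ⟨j, h⟩) =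
      chi n (FreeGroup.of ⟨j, h⟩) * σ (n + 1) (i + 2) := by
  rw [chi_of]
  change Commute _ _
  rcases Nat.lt_or_gt_of_ne h1 with h3 | h3
  · have c1 : Commute (σ (n + 1) (i + 2)) (descend (n + 1) j) := σ_descend_comm (by omega)
    have c2 : Commute (σ (n + 1) (i + 2)) (σ (n + 1) (j + 1)) :=
      (σ_comm (by omega) (by omega)).symm
    exact (c1.inv_right.mul_right (c2.pow_right 2)).mul_right c1
  · have e := descend_σ (n := n + 1) (k := j) (i := i) (by omega) (by omega)
    have c2 : Commute (σ (n + 1) (i + 1)) (σ (n + 1) (j + 1)) := σ_comm (by omega) (by omega)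
    have e' : σ (n + 1) (i + 2) =
        (descend (n + 1) j)⁻¹ * σ (n + 1) (i + 1) * descend (n + 1) j := by
      rw [mul_assoc, ← e]; group
    have c3 : σ (n + 1) (i + 1) * σ (n + 1) (j + 1) ^ 2 =
      σ (n + 1) (j + 1) ^ 2 * σ (n + 1) (i + 1) := c2.pow_right 2
    change _ * _ = _ * _
    rw [e']
    calc _ = (descend (n + 1) j)⁻¹ * (σ (n + 1) (i + 1) * σ (n + 1) (j + 1) ^ 2) *
          descend (n + 1) j := by group
      _ = _ := by rw [c3]; group

theorem σ_chi_fst {n i : ℕ} (hi : i + 1 < n) :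
    σ (n + 1) (i + 2) * chi n (FreeGroup.of ⟨i, by omega⟩) =
      chi n (FreeGroup.of ⟨i + 1, hi⟩) * σ (n + 1) (i + 2) := by
  rw [chi_of, chi_of, descend, pow_two, pow_two]
  have c1 := σ_descend_comm (n := n + 1) (k := i) (i := i + 2) (by omega)
  have hb := σ_braid (n := n + 1) (i := i + 1) (by omega) (by omega)
  set s := σ (n + 1) (i + 1)
  set r := σ (n + 1) (i + 2)
  change s * r * s = r * s * r at hb
  change _ = (s * _)⁻¹ * (r * r) * (s * _) * r
  set d := descend (n + 1) i
  have c2 : r * d⁻¹ = d⁻¹ * r := (Commute.inv_right (c1 : Commute r d) : _)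
  calc r * (d⁻¹ * (s * s) * d) = (r * d⁻¹) * (s * s) * d := by group
    _ = d⁻¹ * s⁻¹ * ((s * r * s) * s) * d := by rw [c2]; group
    _ = d⁻¹ * s⁻¹ * (r * (s * r * s)) * d := by nth_rewrite 1 [hb]; group
    _ = d⁻¹ * s⁻¹ * (r * r) * s * (r * d) := by rw [hb]; group
    _ = (s * d)⁻¹ * (r * r) * (s * d) * r := by rw [c1]; group

theorem σ_chi_mul {n i : ℕ} (hi : i + 1 < n) :
    σ (n + 1) (i + 2) *
        (chi n (FreeGroup.of ⟨i, by omega⟩) * chi n (FreeGroup.of ⟨i + 1, hi⟩)) =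
      chi n (FreeGroup.of ⟨i, by omega⟩) * chi n (FreeGroup.of ⟨i + 1, hi⟩) *
        σ (n + 1) (i + 2) := by
  rw [chi_of, chi_of, descend, pow_two, pow_two]
  have c1 := σ_descend_comm (n := n + 1) (k := i) (i := i + 2) (by omega)
  have hb := σ_braid (n := n + 1) (i := i + 1) (by omega) (by omega)
  set s := σ (n + 1) (i + 1)
  set r := σ (n + 1) (i + 2)
  change s * r * s = r * s * r at hb
  change r * (_ * ((s * _)⁻¹ * (r * r) * (s * _))) = (_ * ((s * _)⁻¹ * (r * r) * (s * _))) * r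
  set d := descend (n + 1) i
  have c2 : r * d⁻¹ = d⁻¹ * r := (Commute.inv_right (c1 : Commute r d) : _)
  calc _ = (r * d⁻¹) * (s * r * r * s) * d := by group
    _ = d⁻¹ * ((r * s * r) * r * s) * d := by rw [c2]; group
    _ = d⁻¹ * (s * r * (s * r * s)) * d := by rw [← hb]; group
    _ = d⁻¹ * (s * r * r * s) * (r * d) := by rw [hb]; group
    _ = _ := by rw [c1]; group

theorem shift_gen {n : ℕ} (i : Fin (n - 1)) : shift n (gen i) = σ (n + 1) (i.val + 2) :=
  lift_gen _ _ _ _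

theorem shift_gen_chi {n : ℕ} (i : Fin (n - 1)) (x : FreeGroup (Fin n)) :
    shift n (gen i) * chi n x = chi n (artin n (gen i) x) * shift n (gen i) := by
  rw [shift_gen, artin, lift_gen]
  have h : (MulAut.conj (σ (n + 1) (i.val + 2))).toMonoidHom.comp (chi n) =
      (chi n).comp (artinGen i).toMonoidHom := by
    refine FreeGroup.ext_hom _ _ fun ⟨j, hj⟩ => ?_
    change σ (n + 1) (i.val + 2) * chi n (FreeGroup.of ⟨j, hj⟩) * (σ (n + 1) (i.val + 2))⁻¹ =
      chi n (artinGen i (FreeGroup.of ⟨j, hj⟩))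
    rw [artinGen_of, mul_inv_eq_iff_eq_mul]
    have hi : i.val + 1 < n := by omega
    by_cases h1 : j = i.val
    · subst h1
      rw [artinFun_fst, σ_chi_fst hi]
    by_cases h2 : j = i.val + 1
    · subst h2
      have e1 := σ_chi_mul hi
      have e2 := σ_chi_fst hi
      rw [artinFun_snd, map_mul, map_mul, map_inv, mul_assoc _ _ (chi n _), mul_assoc _ _ (σ _ _),
        ← e1, ← mul_assoc (σ _ _), e2]
      group
    rw [artinFun_other _ _ h1 h2, σ_chi_other hj h1 h2]
  have := DFunLike.congr_fun h x
  exact mul_inv_eq_iff_eq_mul.1 this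

/-- The compatibility of `a_n` and `χ_n` that makes the Long-Moody construction well defined. -/
theorem shift_chi {n : ℕ} (b : BraidGroup n) (x : FreeGroup (Fin n)) :
    shift n b * chi n x = chi n (artin n b x) * shift n b := by
  induction b using induction_gen generalizing x with
  | hg i => exact shift_gen_chi i x
  | h1 => simp
  | hm a b ha hb =>
    rw [map_mul, map_mul, MulAut.mul_apply, mul_assoc, hb, ← mul_assoc, ha, mul_assoc]
  | hi a ha =>
    have := ha ((artin n a)⁻¹ x)
    rw [MulAut.apply_inv_self] at this
    rw [map_inv, map_inv, inv_mul_eq_iff_eq_mul, ← mul_assoc, this]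
    group

end BraidGroup

/-! ### The Long-Moody construction -/

/-- The augmentation ideal `I` of the group ring `ℤ[F_n]`. -/
def augIdeal (n : ℕ) : Submodule ℤ (MonoidAlgebra ℤ (FreeGroup (Fin n))) :=
  LinearMap.ker (MonoidAlgebra.lift ℤ ℤ (FreeGroup (Fin n)) 1).toLinearMap

theorem mem_augIdeal {n : ℕ} (a : MonoidAlgebra ℤ (FreeGroup (Fin n))) :
    a ∈ augIdeal n ↔ MonoidAlgebra.lift ℤ ℤ (FreeGroup (Fin n)) 1 a = 0 := Iff.rfl

/-- Right multiplication by `x ∈ F_n` on the augmentation ideal. -/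
def augRight {n : ℕ} (x : FreeGroup (Fin n)) : augIdeal n →ₗ[ℤ] augIdeal n :=
  (LinearMap.mulRight ℤ (MonoidAlgebra.of ℤ (FreeGroup (Fin n)) x)).restrict fun a ha => by
    rw [mem_augIdeal] at ha ⊢
    rw [LinearMap.mulRight_apply, map_mul, ha, zero_mul]

theorem domCongr_mem {n : ℕ} (e : MulAut (FreeGroup (Fin n)))
    (a : MonoidAlgebra ℤ (FreeGroup (Fin n))) (ha : a ∈ augIdeal n) :
    MonoidAlgebra.domCongr ℤ ℤ e a ∈ augIdeal n := by
  have h : (MonoidAlgebra.lift ℤ ℤ (FreeGroup (Fin n)) 1).comp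
      (MonoidAlgebra.domCongr ℤ ℤ e).toAlgHom = MonoidAlgebra.lift ℤ ℤ (FreeGroup (Fin n)) 1 :=
    MonoidAlgebra.algHom_ext' (MonoidHom.ext fun x => by simp) (Subsingleton.elim _ _)
  rw [mem_augIdeal] at ha ⊢
  rw [← ha]
  exact DFunLike.congr_fun h a

/-- The action of `B_n` on the augmentation ideal of `ℤ[F_n]` that is induced by `a_n`. -/
def augAction (n : ℕ) : BraidGroup n →* (augIdeal n →ₗ[ℤ] augIdeal n) where
  toFun b := (MonoidAlgebra.domCongr ℤ ℤ (BraidGroup.artin n b)).toLinearMap.restrict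
    (domCongr_mem (BraidGroup.artin n b))
  map_one' := by
    refine LinearMap.ext fun a => Subtype.ext ?_
    rw [map_one]
    change MonoidAlgebra.domCongrAut (R := ℤ) (A := ℤ) (1 : MulAut (FreeGroup (Fin n))) a.val = a.val
    rw [map_one]
    rfl
  map_mul' b c := by
    refine LinearMap.ext fun a => Subtype.ext ?_
    rw [map_mul]
    change MonoidAlgebra.domCongrAut (R := ℤ) (A := ℤ)
      (BraidGroup.artin n b * BraidGroup.artin n c) a.val = _
    rw [map_mul]
    rfl

theorem augAction_augRight {n : ℕ} (b : BraidGroup n) (x : FreeGroup (Fin n)) (a : augIdeal n) :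
    augAction n b (augRight x a) = augRight (BraidGroup.artin n b x) (augAction n b a) := by
  refine Subtype.ext ?_
  change MonoidAlgebra.domCongr ℤ ℤ (BraidGroup.artin n b)
      (a.val * MonoidAlgebra.of ℤ (FreeGroup (Fin n)) x) =
    MonoidAlgebra.domCongr ℤ ℤ (BraidGroup.artin n b) a.val *
      MonoidAlgebra.of ℤ (FreeGroup (Fin n)) (BraidGroup.artin n b x)
  rw [map_mul]
  simp

section LongMoody

variable {R : Type*} [CommRing R] {V : Type*} [AddCommGroup V] [Module R V] {n : ℕ}

/-- The submodule of `V ⊗_ℤ I` that is generated by the differences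
`v ⊗ (i · x) - (x · v) ⊗ i` for `x ∈ F_n`, `v ∈ V`, `i ∈ I`, where `F_n` acts on `V`
through `ρ ∘ χ_n`. -/
def longMoodyRel (ρ : Representation R (BraidGroup (n + 1)) V) : Submodule R (V ⊗[ℤ] augIdeal n) :=
  Submodule.span R {z | ∃ (v : V) (x : FreeGroup (Fin n)) (i : augIdeal n),
    z = v ⊗ₜ[ℤ] augRight x i - ρ (BraidGroup.chi n x) v ⊗ₜ[ℤ] i}

/-- The tensor product `I ⊗_{ℤ[F_n]} V` of the right module `I` (the augmentation ideal of `ℤ[F_n]`)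
with the left module `V`, as an `R`-module through `V`. The two factors are written in the opposite
order, since Mathlib lets scalars act on the left factor. -/
abbrev LongMoodyModule (ρ : Representation R (BraidGroup (n + 1)) V) : Type _ :=
  (V ⊗[ℤ] augIdeal n) ⧸ longMoodyRel ρ

/-- The endomorphism `v ⊗ i ↦ ρ(id_1 ♮ b)(v) ⊗ a_n(b)(i)` of `V ⊗_ℤ I`. -/
def longMoodyPre (ρ : Representation R (BraidGroup (n + 1)) V) (b : BraidGroup n) :
    (V ⊗[ℤ] augIdeal n) →ₗ[R] (V ⊗[ℤ] augIdeal n) :=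
  TensorProduct.AlgebraTensorModule.map (ρ (BraidGroup.shift n b)) (augAction n b)

theorem longMoodyPre_tmul (ρ : Representation R (BraidGroup (n + 1)) V) (b : BraidGroup n) (v : V)
    (i : augIdeal n) : longMoodyPre ρ b (v ⊗ₜ[ℤ] i) =
      ρ (BraidGroup.shift n b) v ⊗ₜ[ℤ] augAction n b i := rfl

theorem longMoodyPre_le (ρ : Representation R (BraidGroup (n + 1)) V) (b : BraidGroup n) :
    longMoodyRel ρ ≤ (longMoodyRel ρ).comap (longMoodyPre ρ b) := by
  refine Submodule.span_le.2 ?_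
  rintro _ ⟨v, x, i, rfl⟩
  refine Submodule.subset_span
    ⟨ρ (BraidGroup.shift n b) v, BraidGroup.artin n b x, augAction n b i, ?_⟩
  rw [map_sub, longMoodyPre_tmul, longMoodyPre_tmul, augAction_augRight,
    ← Module.End.mul_apply (ρ _) (ρ _), ← map_mul ρ, BraidGroup.shift_chi, map_mul ρ,
    Module.End.mul_apply]

/-- The Long-Moody construction `LM(ρ)`, a representation of `B_n` on `I ⊗_{ℤ[F_n]} V` for a
representation `ρ` of `B_{n+1}` on `V`:
`LM(ρ)(b)(i ⊗ v) = a_n(b)(i) ⊗ ρ(id_1 ♮ b)(v)`. -/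
def longMoody (ρ : Representation R (BraidGroup (n + 1)) V) :
    Representation R (BraidGroup n) (LongMoodyModule ρ) where
  toFun b := (longMoodyRel ρ).mapQ (longMoodyRel ρ) (longMoodyPre ρ b) (longMoodyPre_le ρ b)
  map_one' := by
    have h : longMoodyPre ρ (1 : BraidGroup n) = LinearMap.id := by
      unfold longMoodyPre
      rw [map_one, map_one, map_one]
      exact TensorProduct.AlgebraTensorModule.map_one
    simp only [h]
    exact Submodule.mapQ_id _
  map_mul' b c := by
    have h : longMoodyPre ρ (b * c) = (longMoodyPre ρ b).comp (longMoodyPre ρ c) := by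
      unfold longMoodyPre
      rw [map_mul, map_mul, map_mul]
      exact TensorProduct.AlgebraTensorModule.map_mul _ _ _ _
    simp only [h]
    exact Submodule.mapQ_comp _ _ _ _ _ _ _

/-- The tensor product of a representation of `B_n` with the one-dimensional representation that
sends every Artin generator to multiplication by `u`. -/
def twist {n : ℕ} (u : Rˣ) (ρ : Representation R (BraidGroup n) V) :
    Representation R (BraidGroup n) V where
  toFun b := (BraidGroup.const n u b : R) • ρ b
  map_one' := by simp
  map_mul' b c := by
    rw [map_mul, map_mul, Units.val_mul, smul_mul_smul_comm]

end LongMoody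

/-! ### The representations over `ℤ[t^{±1}, q^{±1}]` -/

/-- The ring `ℤ[t^{±1}, q^{±1}]`, as Laurent polynomials in `q` over `ℤ[t^{±1}]`. -/
abbrev LaurentTQ : Type := LaurentPolynomial (LaurentPolynomial ℤ)

/-- The unit `T` of a ring of Laurent polynomials. -/
def laurentVar (A : Type*) [CommRing A] : (LaurentPolynomial A)ˣ where
  val := LaurentPolynomial.T 1
  inv := LaurentPolynomial.T (-1)
  val_inv := by rw [← LaurentPolynomial.T_add]; simp
  inv_val := by rw [← LaurentPolynomial.T_add]; simp

/-- The variable `q`. -/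
def varQ : LaurentTQˣ := laurentVar (LaurentPolynomial ℤ)

/-- The variable `t`. -/
def varT : LaurentTQˣ :=
  Units.map (LaurentPolynomial.C (R := LaurentPolynomial ℤ)).toMonoidHom (laurentVar ℤ)

/-- The representation `LM_q(TYM_{n+1})` of `B_n`, that is the Long-Moody construction applied to
the twist of `TYM_{n+1}` by `q`, and then twisted by `q⁻¹`. -/
def LMqTYM (n : ℕ) : Representation LaurentTQ (BraidGroup n)
    (LongMoodyModule (twist varQ (tongYangMa (n + 1) varT))) :=
  twist varQ⁻¹ (longMoody (twist varQ (tongYangMa (n + 1) varT)))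

/-- The representation `τ_1 LM_q(TYM_{n+1})` of `B_n`, that is the representation `LM_q(TYM_{n+2})`
of `B_{n+1}` restricted to `B_n` along `id_1 ♮ -`. -/
def tauLMqTYM (n : ℕ) : Representation LaurentTQ (BraidGroup n)
    (LongMoodyModule (twist varQ (tongYangMa (n + 1 + 1) varT))) :=
  (LMqTYM (n + 1)).comp (BraidGroup.shift n)

/-! ### Elements of the kernel of the Burau representation -/

namespace BraidGroup

/-- The commutator `σ ∈ B_5`. -/
def sigma5 : BraidGroup 5 :=
  let s := σ 5
  let ψ₁ := (s 3)⁻¹ * s 2 * s 1 ^ 2 * s 2 * s 4 ^ 3 * s 3 * s 2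
  let ψ₂ := (s 4)⁻¹ * s 3 * s 2 * (s 1 ^ 2)⁻¹ * s 2 * s 1 ^ 2 * s 2 ^ 2 * s 1 * s 4 ^ 5
  comm (ψ₁⁻¹ * s 4 * ψ₁) (ψ₂⁻¹ * (s 4 * s 3 * s 2 * s 1 ^ 2 * s 2 * s 3 * s 4) * ψ₂)

/-- The commutator `τ ∈ B_6`. -/
def tau6 : BraidGroup 6 :=
  let s := σ 6
  let δ₁ := s 4 * (s 5)⁻¹ * (s 2)⁻¹ * s 1
  let δ₂ := (s 4)⁻¹ * s 5 ^ 2 * s 2 * (s 1 ^ 2)⁻¹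
  comm (δ₁⁻¹ * s 3 * δ₁) (δ₂⁻¹ * s 3 * δ₂)

/-- The braid `θ ∈ B_6`. -/
def theta6 : BraidGroup 6 :=
  let s := σ 6
  (s 5)⁻¹ * (s 4)⁻¹ * s 5 * (s 3)⁻¹ * s 4 * (s 2)⁻¹ * (s 3 ^ 3)⁻¹ * s 1 ^ 3 * s 5 * s 4 *
    (s 3)⁻¹ * (s 2)⁻¹ * s 1

/-- The commutator `ξ ∈ B_6`. -/
def xi6 : BraidGroup 6 :=
  let s := σ 6
  comm (theta6⁻¹ * s 5 * theta6) ((s 2 * s 3 * s 4 * s 5) ^ 5)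

/-- The commutator `ν ∈ B_7`. -/
def nu7 : BraidGroup 7 :=
  let s := σ 7
  comm (s 1) ((shift 6 theta6)⁻¹ * s 6 * shift 6 theta6)

end BraidGroup

end

/-! Let `τ` be the representation `τ_1 LM_q(TYM_{n+1})` of `B_n`.

The augmentation ideal `I` of `ℤ[F_{n+1}]` is a free right module on the elements `x_l - 1`, so the
Long-Moody module is spanned by the vectors `(x_l - 1) ⊗ v`, and Fox derivatives give the
coordinates (`lmCoord_lmClass`). Every braid acts on the Tong-Yang-Ma representation by a monomial
matrix, and each `x_l` acts on a basis vector `e_k` with `k ≥ 2` by a scalar: by `q² t` if `x_l` is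
the loop around strand `k`, that is if `k = l + 1`, and by `q²` otherwise
(`twist_tongYangMa_chi`). On `(x_l - 1) ⊗ e_k` the Artin generators therefore act by Burau blocks
whose entries depend on the position of the marked strand `k`. This is recorded in `IsBraidFrame`.

After two shifts the braids in `B_n` fix the vector `e_2`. For `l ≥ 2` the loops `x_l` act on it by
the same scalar `q²`, so the vectors `(x_l - 1) ⊗ e_2` with `l ≥ 2` span a copy of the Burau
representation with parameter `q²`. Hence the kernel of `τ` is contained in the kernel of Burau
(`ker_tauLM_le_ker_burau`).

A commutator of `a` and `b` lies in the kernel of a representation if and only if `ab` and `ba` act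
in the same way. For Burau this is checked on the basis vectors with explicit Laurent polynomials
(`burauTest`). For `τ`, the coordinates of the image of one vector `(x_l - 1) ⊗ e_k` with `k ≥ 3`
are specialized to `ZMod 5` by `q ↦ 2`, `t ↦ -1`, and the results for `ab` and `ba` differ
(`ModFiveDiffer`). Both computations are the function `StrandWeights.run`, which
`IsBraidFrame.exists_run` relates to the representations. The words of the commutator in `B_5` also
give a braid in `B_n` for all `n ≥ 5`, with the same two computations, which proves that the
inclusion is strict. -/

open scoped TensorProduct

noncomputable section

/-! ### Generators of the Long-Moody module -/

/-- The element `y - 1` of the augmentation ideal of `ℤ[F_n]`, for `y ∈ F_n`. -/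
def augSub {n : ℕ} (y : FreeGroup (Fin n)) : augIdeal n :=
  ⟨MonoidAlgebra.of ℤ _ y - 1, by rw [mem_augIdeal]; simp⟩

/-- The Fox rule for products. -/
theorem augSub_mul {n : ℕ} (y z : FreeGroup (Fin n)) :
    augSub (y * z) = augRight z (augSub y) + augSub z := by
  refine Subtype.ext ?_
  change MonoidAlgebra.of ℤ _ (y * z) - 1 =
    (MonoidAlgebra.of ℤ _ y - 1) * MonoidAlgebra.of ℤ _ z + (MonoidAlgebra.of ℤ _ z - 1)
  rw [map_mul]
  noncomm_ring

theorem augSub_one {n : ℕ} : augSub (1 : FreeGroup (Fin n)) = 0 := by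
  refine Subtype.ext ?_
  change MonoidAlgebra.of ℤ _ 1 - 1 = 0
  rw [map_one, sub_self]

theorem augAction_augSub {n : ℕ} (b : BraidGroup n) (y : FreeGroup (Fin n)) :
    augAction n b (augSub y) = augSub (BraidGroup.artin n b y) := by
  refine Subtype.ext ?_
  change MonoidAlgebra.domCongr ℤ ℤ (BraidGroup.artin n b) (MonoidAlgebra.of ℤ _ y - 1) =
    MonoidAlgebra.of ℤ _ (BraidGroup.artin n b y) - 1
  rw [map_sub, map_one]
  simp

section LongMoody

variable {R : Type*} [CommRing R] {V : Type*} [AddCommGroup V] [Module R V] {n : ℕ}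
  (ρ : Representation R (BraidGroup (n + 1)) V)

/-- The linear map `v ↦ (y - 1) ⊗ v` from `V` to the Long-Moody module. -/
def lmClass (y : FreeGroup (Fin n)) : V →ₗ[R] LongMoodyModule ρ :=
  (longMoodyRel ρ).mkQ ∘ₗ (TensorProduct.AlgebraTensorModule.mk ℤ R V (augIdeal n)).flip (augSub y)

theorem lmClass_apply (y : FreeGroup (Fin n)) (v : V) :
    lmClass ρ y v = (longMoodyRel ρ).mkQ (v ⊗ₜ augSub y) := rfl

theorem lmClass_one (v : V) : lmClass ρ 1 v = 0 := by
  rw [lmClass_apply, augSub_one, TensorProduct.tmul_zero, map_zero]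

theorem lmClass_mul (y z : FreeGroup (Fin n)) (v : V) :
    lmClass ρ (y * z) v = lmClass ρ y (ρ (BraidGroup.chi n z) v) + lmClass ρ z v := by
  rw [lmClass_apply, lmClass_apply, lmClass_apply, augSub_mul, TensorProduct.tmul_add, map_add,
    add_left_inj, ← sub_eq_zero, ← map_sub, Submodule.mkQ_apply, Submodule.Quotient.mk_eq_zero]
  exact Submodule.subset_span ⟨v, z, augSub y, rfl⟩

theorem longMoody_lmClass (b : BraidGroup n) (y : FreeGroup (Fin n)) (v : V) :
    longMoody ρ b (lmClass ρ y v) =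
      lmClass ρ (BraidGroup.artin n b y) (ρ (BraidGroup.shift n b) v) := by
  rw [lmClass_apply, lmClass_apply, ← augAction_augSub]
  rfl

/-- The Fox rule for a conjugate, on a common eigenvector of the two letters. -/
theorem lmClass_conj (x y : FreeGroup (Fin n)) (v : V) (X Y : R)
    (hx : ρ (BraidGroup.chi n x) v = X • v) (hy : ρ (BraidGroup.chi n y) v = Y • v) :
    lmClass ρ (y⁻¹ * x * y) v = Y • lmClass ρ x v + (1 - X) • lmClass ρ y v := by
  have h : Y • lmClass ρ y⁻¹ v = - lmClass ρ y v := by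
    have := lmClass_mul ρ y⁻¹ y v
    rw [inv_mul_cancel, lmClass_one, hy, map_smul] at this
    exact eq_neg_of_add_eq_zero_left this.symm
  rw [lmClass_mul, hy, map_smul, lmClass_mul, hx, map_smul, smul_add, smul_comm Y X, h]
  module

theorem longMoody_gen_fst (i : Fin (n - 1)) (h : i.val < n) (v : V) :
    longMoody ρ (BraidGroup.gen i) (lmClass ρ (FreeGroup.of ⟨i.val, h⟩) v) =
      lmClass ρ (FreeGroup.of ⟨i.val + 1, by omega⟩) (ρ (BraidGroup.σ (n + 1) (i.val + 2)) v) := by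
  rw [longMoody_lmClass, BraidGroup.shift_gen, BraidGroup.artin, BraidGroup.lift_gen,
    BraidGroup.artinGen_of, BraidGroup.artinFun_fst]

theorem longMoody_gen_snd (i : Fin (n - 1)) (h : i.val + 1 < n) (v w : V) (X Y : R)
    (hw : ρ (BraidGroup.σ (n + 1) (i.val + 2)) v = w)
    (hx : ρ (BraidGroup.chi n (FreeGroup.of ⟨i.val, by omega⟩)) w = X • w)
    (hy : ρ (BraidGroup.chi n (FreeGroup.of ⟨i.val + 1, h⟩)) w = Y • w) :
    longMoody ρ (BraidGroup.gen i) (lmClass ρ (FreeGroup.of ⟨i.val + 1, h⟩) v) =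
      Y • lmClass ρ (FreeGroup.of ⟨i.val, by omega⟩) w +
        (1 - X) • lmClass ρ (FreeGroup.of ⟨i.val + 1, h⟩) w := by
  rw [longMoody_lmClass, BraidGroup.shift_gen, BraidGroup.artin, BraidGroup.lift_gen,
    BraidGroup.artinGen_of, BraidGroup.artinFun_snd, hw]
  exact lmClass_conj ρ _ _ w X Y hx hy

theorem longMoody_gen_other (i : Fin (n - 1)) (j : Fin n) (h1 : j.val ≠ i.val)
    (h2 : j.val ≠ i.val + 1) (v : V) :
    longMoody ρ (BraidGroup.gen i) (lmClass ρ (FreeGroup.of j) v) =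
      lmClass ρ (FreeGroup.of j) (ρ (BraidGroup.σ (n + 1) (i.val + 2)) v) := by
  rw [longMoody_lmClass, BraidGroup.shift_gen, BraidGroup.artin, BraidGroup.lift_gen,
    BraidGroup.artinGen_of, BraidGroup.artinFun_other _ _ h1 h2]

/-! ### Fox derivatives -/

/-- The matrix `(A, 0; D, 1)` with `A` the action of a group element `x` and `D` an
endomorphism, as a unit. -/
def foxUnit (x : BraidGroup (n + 1)) (D : Module.End R V) :
    (Matrix (Fin 2) (Fin 2) (Module.End R V))ˣ where
  val := !![ρ x, 0; D, 1]
  inv := !![ρ x⁻¹, 0; -(D * ρ x⁻¹), 1]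
  val_inv := by
    have h : ρ x * ρ x⁻¹ = 1 := by rw [← map_mul, mul_inv_cancel, map_one]
    ext1 a b
    fin_cases a <;> fin_cases b <;> simp [Matrix.mul_apply, h]
  inv_val := by
    have h : ρ x⁻¹ * ρ x = 1 := by rw [← map_mul, inv_mul_cancel, map_one]
    ext1 a b
    fin_cases a <;> fin_cases b <;> simp [Matrix.mul_apply, h, mul_assoc]

/-- The homomorphism `y ↦ (ρ(χ_n(y)), 0; ∂_j y, 1)` on `F_n`, in which the crossed homomorphism
`∂_j` is the `j`-th Fox derivative followed by the action on `V`. -/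
def foxHom (j : Fin n) :
    FreeGroup (Fin n) →* Matrix (Fin 2) (Fin 2) (Module.End R V) :=
  (Units.coeHom _).comp (FreeGroup.lift fun l =>
    foxUnit ρ (BraidGroup.chi n (FreeGroup.of l)) (if l = j then 1 else 0))

theorem foxHom_of (j l : Fin n) : foxHom ρ j (FreeGroup.of l) =
    !![ρ (BraidGroup.chi n (FreeGroup.of l)), 0; if l = j then 1 else 0, 1] := by
  simp [foxHom, foxUnit]

/-- The values of `foxHom` are lower triangular; only the entry `(1, 0)` carries new
information. -/
theorem foxHom_shape (j : Fin n) (y : FreeGroup (Fin n)) :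
    foxHom ρ j y 0 0 = ρ (BraidGroup.chi n y) ∧ foxHom ρ j y 0 1 = 0 ∧ foxHom ρ j y 1 1 = 1 := by
  have hmul : ∀ y z, (foxHom ρ j y 0 0 = ρ (BraidGroup.chi n y) ∧ foxHom ρ j y 0 1 = 0 ∧
      foxHom ρ j y 1 1 = 1) → (foxHom ρ j z 0 0 = ρ (BraidGroup.chi n z) ∧ foxHom ρ j z 0 1 = 0 ∧
      foxHom ρ j z 1 1 = 1) → (foxHom ρ j (y * z) 0 0 = ρ (BraidGroup.chi n (y * z)) ∧
      foxHom ρ j (y * z) 0 1 = 0 ∧ foxHom ρ j (y * z) 1 1 = 1) := by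
    rintro y z ⟨h1, h2, h3⟩ ⟨h4, h5, h6⟩
    rw [map_mul, map_mul, map_mul]
    simp [Matrix.mul_apply, Fin.sum_univ_two, h1, h2, h3, h4, h5, h6]
  induction y with
  | C1 => simp
  | of l => simp [foxHom_of]
  | inv_of l _ =>
    have : foxHom ρ j (FreeGroup.of l)⁻¹ =
        ((foxUnit ρ (BraidGroup.chi n (FreeGroup.of l)) (if l = j then 1 else 0))⁻¹ :
          (Matrix (Fin 2) (Fin 2) (Module.End R V))ˣ).val := by
      simp [foxHom]
    rw [this]
    simp [foxUnit]
  | mul y z hy hz => exact hmul y z hy hz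

/-- The additive extension of `∂_j` to `ℤ[F_n]`. -/
def foxLin (j : Fin n) : MonoidAlgebra ℤ (FreeGroup (Fin n)) →ₗ[ℤ] Module.End R V where
  toFun a := MonoidAlgebra.lift ℤ _ _ (foxHom ρ j) a 1 0
  map_add' a b := by rw [map_add]; rfl
  map_smul' c a := by rw [map_smul]; rfl

theorem foxLin_of (j : Fin n) (y : FreeGroup (Fin n)) :
    foxLin ρ j (MonoidAlgebra.of ℤ _ y) = foxHom ρ j y 1 0 := by
  simp [foxLin]

/-- The map `foxLin` is compatible with the right action of `F_n`. The elements of `I` have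
augmentation `0`, so that the second summand in the Fox rule vanishes. -/
theorem foxLin_mul_of (j : Fin n) (a : augIdeal n) (x : FreeGroup (Fin n)) :
    foxLin ρ j (augRight x a).val = foxLin ρ j a.val * ρ (BraidGroup.chi n x) := by
  have h11 : ∀ a : MonoidAlgebra ℤ (FreeGroup (Fin n)),
      MonoidAlgebra.lift ℤ _ _ (foxHom ρ j) a 1 1 =
        ((MonoidAlgebra.lift ℤ ℤ (FreeGroup (Fin n)) 1 a : ℤ) : Module.End R V) := by
    intro a
    induction a using MonoidAlgebra.induction_on with
    | of y => simp [(foxHom_shape ρ j y).2.2]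
    | add a b ha hb => rw [map_add, map_add, Matrix.add_apply, ha, hb, Int.cast_add]
    | smul c a ha => rw [map_smul, map_smul, Matrix.smul_apply, ha]; simp
  change MonoidAlgebra.lift ℤ _ _ (foxHom ρ j) (a.val * MonoidAlgebra.of ℤ _ x) 1 0 = _
  rw [map_mul, Matrix.mul_apply, Fin.sum_univ_two, h11, (mem_augIdeal _).1 a.2]
  simp [foxLin, (foxHom_shape ρ j x).1]

/-- The `j`-th coordinate `I ⊗_{ℤ[F_n]} V → V` of the Long-Moody module with respect to the basis
`x_1 - 1, …, x_n - 1` of the free right module `I`. -/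
def lmCoord (j : Fin n) : LongMoodyModule ρ →ₗ[R] V :=
  (longMoodyRel ρ).liftQ (TensorProduct.AlgebraTensorModule.lift
    { toFun := fun v =>
        { toFun := fun i => foxLin ρ j i.val v
          map_add' := fun a b => by simp
          map_smul' := fun c a => by rw [Submodule.coe_smul, map_smul]; rfl }
      map_add' := fun v w => by ext; simp
      map_smul' := fun c v => by ext; simp }) (by
    refine Submodule.span_le.2 ?_
    rintro _ ⟨v, x, i, rfl⟩
    simp [foxLin_mul_of])

theorem lmCoord_lmClass (j l : Fin n) (v : V) :
    lmCoord ρ j (lmClass ρ (FreeGroup.of l) v) = if l = j then v else 0 := by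
  change foxLin ρ j (MonoidAlgebra.of ℤ _ (FreeGroup.of l) - 1) v = _
  have h1 : foxLin ρ j (1 : MonoidAlgebra ℤ (FreeGroup (Fin n))) = 0 := by simp [foxLin]
  rw [map_sub, h1, sub_zero, foxLin_of, foxHom_of]
  split_ifs with h <;> simp

end LongMoody

/-! ### Braid words and their action on weighted strands -/

/-- The transposition `(i, i + 1)` of positions. -/
def strandSwap (i k : ℕ) : ℕ := if k = i then i + 1 else if k = i + 1 then i else k

theorem strandSwap_strandSwap (i k : ℕ) : strandSwap i (strandSwap i k) = k := by
  unfold strandSwap; split_ifs <;> omega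

/-- The braid `σ_{i+1}` or `σ_{i+1}⁻¹` in `B_n` that the letter `(i, true)` or `(i, false)`
stands for. -/
def braidLetter (n : ℕ) (a : ℕ × Bool) : BraidGroup n :=
  if a.2 then BraidGroup.σ n (a.1 + 1) else (BraidGroup.σ n (a.1 + 1))⁻¹

/-- The braid in `B_n` of a word. -/
def braidWord (n : ℕ) (w : List (ℕ × Bool)) : BraidGroup n := (w.map (braidLetter n)).prod

theorem braidWord_cons (n : ℕ) (a : ℕ × Bool) (w : List (ℕ × Bool)) :
    braidWord n (a :: w) = braidLetter n a * braidWord n w := by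
  simp [braidWord]

theorem braidWord_append (n : ℕ) (v w : List (ℕ × Bool)) :
    braidWord n (v ++ w) = braidWord n v * braidWord n w := by
  simp [braidWord]

/-- Two parameters `u`, `t` and their inverses. No ring laws are asked of `A`, so that computations
can be run in any type with the ring operations. -/
structure StrandWeights (A : Type*) where
  /-- The parameter `u`. -/
  u : A
  /-- The inverse of `u`. -/
  u' : A
  /-- The parameter `t`. -/
  t : A
  /-- The inverse of `t`. -/
  t' : A

namespace StrandWeights

section UnitList

variable {A : Type*} [Zero A] [One A]

/-- The list of coordinates of the basis vector with index `l`. -/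
def unitList (A : Type*) [Zero A] [One A] : ℕ → List A
  | 0 => [1]
  | l + 1 => 0 :: unitList A l

theorem unitList_getD (l j : ℕ) : (unitList A l).getD j 0 = if j = l then 1 else 0 := by
  induction l generalizing j with
  | zero => cases j <;> simp [unitList]
  | succ l ih => cases j <;> simp [unitList, ← ih]

end UnitList

section Computation

variable {A : Type*} [Zero A] [One A] [Add A] [Sub A] [Mul A]

/-- The eigenvalue of the free generator with index `j` on the basis vector of strand `k`. -/
def wt (P : StrandWeights A) (k j : ℕ) : A := if j = k then P.u * P.t else P.u

/-- The inverse of `wt`. -/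
def wt' (P : StrandWeights A) (k j : ℕ) : A := if j = k then P.u' * P.t' else P.u'

/-- The scalar that a letter contributes when the marked strand is in position `k`. -/
def scal (P : StrandWeights A) (k : ℕ) (a : ℕ × Bool) : A :=
  if a.2 then (if k = a.1 then P.t else 1) else (if k = a.1 + 1 then P.t' else 1)

/-- The entries `(m₀₀, m₀₁, m₁₀, m₁₁)` of the `2 × 2` block by which a letter acts when the marked
strand is in position `k`. -/
def block (P : StrandWeights A) (k : ℕ) (a : ℕ × Bool) : A × A × A × A :=
  if a.2 then (0, P.wt (strandSwap a.1 k) (a.1 + 1), 1, 1 - P.wt (strandSwap a.1 k) a.1)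
  else ((P.wt k a.1 - 1) * P.wt' k (a.1 + 1), 1, P.wt' k (a.1 + 1), 0)

/-- The action of a scalar times a `2 × 2` block in positions `i` and `i + 1` on a list of
coordinates; missing coordinates count as `0`. -/
def blockList (s : A) (m : A × A × A × A) : ℕ → List A → List A
  | 0, L => (s * (m.1 * L.getD 0 0 + m.2.1 * L.getD 1 0)) ::
      (s * (m.2.2.1 * L.getD 0 0 + m.2.2.2 * L.getD 1 0)) :: (L.drop 2).map (s * ·)
  | i + 1, L => (s * L.getD 0 0) :: blockList s m i L.tail

/-- The action of a word on a position of the marked strand and a list of coordinates; the last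
letter acts first. -/
def run (P : StrandWeights A) : List (ℕ × Bool) → ℕ × List A → ℕ × List A
  | [], x => x
  | a :: w, x =>
    let y := P.run w x
    (strandSwap a.1 y.1, blockList (P.scal y.1 a) (P.block y.1 a) a.1 y.2)

/-- The counterpart of `blockList` on sequences of coordinates. -/
def blockFun (s : A) (m : A × A × A × A) (i : ℕ) (c : ℕ → A) (l : ℕ) : A :=
  if l = i then s * (m.1 * c i + m.2.1 * c (i + 1))
  else if l = i + 1 then s * (m.2.2.1 * c i + m.2.2.2 * c (i + 1)) else s * c l

end Computation

section Ring

variable {R : Type*} [CommRing R]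

/-- The parameters given by two units of a commutative ring. -/
def ofUnits (u t : Rˣ) : StrandWeights R := ⟨u, (u⁻¹ : Rˣ), t, (t⁻¹ : Rˣ)⟩

theorem ofUnits_wt_mul (u t : Rˣ) (k j : ℕ) : (ofUnits u t).wt k j * (ofUnits u t).wt' k j = 1 := by
  unfold wt wt' ofUnits
  split_ifs
  · rw [mul_mul_mul_comm]; simp
  · simp

theorem ofUnits_scal_mul (u t : Rˣ) (i k : ℕ) :
    (ofUnits u t).scal (strandSwap i k) (i, true) * (ofUnits u t).scal k (i, false) = 1 := by
  simp only [scal, strandSwap, ofUnits, if_true, Bool.false_eq_true, if_false]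
  split_ifs <;> first | omega | simp

/-- A positive letter undoes the corresponding negative letter. -/
theorem blockFun_pos_neg (u t : Rˣ) (i k : ℕ) (c : ℕ → R) :
    blockFun ((ofUnits u t).scal (strandSwap i k) (i, true))
      ((ofUnits u t).block (strandSwap i k) (i, true)) i
      (blockFun ((ofUnits u t).scal k (i, false)) ((ofUnits u t).block k (i, false)) i c) = c := by
  funext l
  have hs := ofUnits_scal_mul u t i k
  have hY := ofUnits_wt_mul u t k (i + 1)
  generalize (ofUnits u t).scal (strandSwap i k) (i, true) = s at hs ⊢
  generalize (ofUnits u t).scal k (i, false) = s' at hs ⊢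
  simp only [block, strandSwap_strandSwap, if_true, Bool.false_eq_true, if_false]
  generalize (ofUnits u t).wt k i = X
  generalize (ofUnits u t).wt k (i + 1) = Y at hY ⊢
  generalize (ofUnits u t).wt' k (i + 1) = Y' at hY ⊢
  unfold blockFun
  by_cases h1 : l = i
  · subst h1
    simp only [if_true, Nat.succ_ne_self, if_false]
    linear_combination (Y * Y' * c l) * hs + c l * hY
  by_cases h2 : l = i + 1
  · subst h2
    simp only [if_true, Nat.succ_ne_self, if_false]
    linear_combination c (i + 1) * hs
  simp only [h1, h2, if_false]
  linear_combination c l * hs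

end Ring

section Transfer

variable {A S R : Type*} [Zero A] [One A] [Add A] [Sub A] [Mul A] [CommRing S] [CommRing R]

/-- The map `f : A → S` respects the ring operations that `run` uses. A ring homomorphism would
need ring laws in `A`. -/
structure Respects (f : A → S) : Prop where
  map_zero : f 0 = 0
  map_one : f 1 = 1
  map_add : ∀ x y, f (x + y) = f x + f y
  map_sub : ∀ x y, f (x - y) = f x - f y
  map_mul : ∀ x y, f (x * y) = f x * f y

/-- The parameters `P` over `A` and `Q` over `R` have the same images in `S`. -/
structure Matches (f : A → S) (g : R →+* S) (P : StrandWeights A) (Q : StrandWeights R) : Prop where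
  u : f P.u = g Q.u
  u' : f P.u' = g Q.u'
  t : f P.t = g Q.t
  t' : f P.t' = g Q.t'

variable {f : A → S} {g : R →+* S} {P : StrandWeights A} {Q : StrandWeights R}

theorem getD_blockList (hf : Respects f) (s : A) (m : A × A × A × A) (s' : R)
    (m' : R × R × R × R) (hs : f s = g s') (h1 : f m.1 = g m'.1) (h2 : f m.2.1 = g m'.2.1)
    (h3 : f m.2.2.1 = g m'.2.2.1) (h4 : f m.2.2.2 = g m'.2.2.2) (i : ℕ) (L : List A) (c : ℕ → R)
    (hL : ∀ l, f (L.getD l 0) = g (c l)) (l : ℕ) :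
    f ((blockList s m i L).getD l 0) = g (blockFun s' m' i c l) := by
  induction i generalizing L c l with
  | zero =>
    rcases l with _ | _ | l
    · simp only [blockList, List.getD_cons_zero, blockFun, if_true, hf.map_mul, hf.map_add, hL,
        hs, h1, h2, _root_.map_mul, _root_.map_add]
    · simp only [blockList, List.getD_cons_zero, List.getD_cons_succ, blockFun, if_true,
        hf.map_mul, hf.map_add, hL, hs, h3, h4]
      simp
    · have := hL (l + 2)
      simp only [blockList, List.getD_cons_succ, blockFun]
      rw [if_neg (by omega), if_neg (by omega), _root_.map_mul, ← hs, ← this]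
      simp only [List.getD_eq_getElem?_getD, List.getElem?_map, List.getElem?_drop,
        Nat.add_comm 2 l]
      rcases L[l + 2]? with _ | x
      · simp [hf.map_zero]
      · simp [hf.map_mul]
  | succ i ih =>
    rcases l with _ | l
    · rw [blockList, List.getD_cons_zero, hf.map_mul, hs, hL 0]
      simp [blockFun]
    · have := ih L.tail (fun l => c (l + 1)) (fun l => by
        rw [← hL (l + 1)]; cases L <;> simp) l
      simp only [blockList, List.getD_cons_succ]
      rw [this]
      simp [blockFun]

theorem Matches.wt (hf : Respects f) (h : Matches f g P Q) (k j : ℕ) :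
    f (P.wt k j) = g (Q.wt k j) := by
  unfold StrandWeights.wt
  split_ifs <;> simp [hf.map_mul, h.u, h.t]

theorem Matches.wt' (hf : Respects f) (h : Matches f g P Q) (k j : ℕ) :
    f (P.wt' k j) = g (Q.wt' k j) := by
  unfold StrandWeights.wt'
  split_ifs <;> simp [hf.map_mul, h.u', h.t']

theorem Matches.scal (hf : Respects f) (h : Matches f g P Q) (k : ℕ) (a : ℕ × Bool) :
    f (P.scal k a) = g (Q.scal k a) := by
  unfold StrandWeights.scal
  split_ifs <;> simp [hf.map_one, h.t, h.t']

/-- One letter on lists of coordinates over `A` follows the same letter over `R`. -/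
theorem Matches.getD_blockList (hf : Respects f) (h : Matches f g P Q) (k : ℕ) (a : ℕ × Bool)
    (L : List A) (c : ℕ → R) (hL : ∀ l, f (L.getD l 0) = g (c l)) (l : ℕ) :
    f ((blockList (P.scal k a) (P.block k a) a.1 L).getD l 0) =
      g (blockFun (Q.scal k a) (Q.block k a) a.1 c l) := by
  refine StrandWeights.getD_blockList hf _ _ _ _ (h.scal hf k a) ?_ ?_ ?_ ?_ _ _ _ hL l <;>
    unfold block <;> split_ifs <;>
    simp [hf.map_zero, hf.map_one, hf.map_sub, hf.map_mul, h.wt hf, h.wt' hf]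

end Transfer

end StrandWeights

/-! ### Frames -/

section Frame

open StrandWeights

variable {R M : Type*} [CommRing R] [AddCommGroup M] [Module R M] {n : ℕ}

/-- A family of vectors `e k l`, where `k` is the position of a marked strand and `l < n` the index
of a coordinate, on which the Artin generators act by the blocks of `StrandWeights`. -/
structure IsBraidFrame (ρ : Representation R (BraidGroup n) M) (Q : StrandWeights R)
    (e : ℕ → ℕ → M) : Prop where
  fst : ∀ i k, i + 1 < n → ρ (BraidGroup.σ n (i + 1)) (e k i) =
    Q.scal k (i, true) • e (strandSwap i k) (i + 1)
  snd : ∀ i k, i + 1 < n → ρ (BraidGroup.σ n (i + 1)) (e k (i + 1)) =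
    Q.scal k (i, true) • (Q.wt (strandSwap i k) (i + 1) • e (strandSwap i k) i +
      (1 - Q.wt (strandSwap i k) i) • e (strandSwap i k) (i + 1))
  other : ∀ i k l, i + 1 < n → l < n → l ≠ i → l ≠ i + 1 → ρ (BraidGroup.σ n (i + 1)) (e k l) =
    Q.scal k (i, true) • e (strandSwap i k) l

/-- The vector with coordinates `c` when the marked strand is in position `k`. -/
def frameVec (n : ℕ) (e : ℕ → ℕ → M) (k : ℕ) (c : ℕ → R) : M := ∑ l ∈ Finset.range n, c l • e k l

variable {ρ : Representation R (BraidGroup n) M} {e : ℕ → ℕ → M}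

theorem IsBraidFrame.map_pos {Q : StrandWeights R} (he : IsBraidFrame ρ Q e) (i k : ℕ)
    (hi : i + 1 < n) (c : ℕ → R) :
    ρ (BraidGroup.σ n (i + 1)) (frameVec n e k c) = frameVec n e (strandSwap i k)
      (blockFun (Q.scal k (i, true)) (Q.block k (i, true)) i c) := by
  -- Only the terms with index `i` and `i + 1` are changed by more than a scalar.
  have split : ∀ F : ℕ → M, ∑ l ∈ Finset.range n, F l =
      F i + (F (i + 1) + ∑ l ∈ ((Finset.range n).erase i).erase (i + 1), F l) := fun F => by
    rw [Finset.add_sum_erase _ F (by simp; omega), Finset.add_sum_erase _ F (by simp; omega)]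
  unfold frameVec
  rw [map_sum, split, split, map_smul, map_smul, he.fst i k hi, he.snd i k hi]
  have : ∀ l ∈ ((Finset.range n).erase i).erase (i + 1),
      ρ (BraidGroup.σ n (i + 1)) (c l • e k l) =
      blockFun (Q.scal k (i, true)) (Q.block k (i, true)) i c l • e (strandSwap i k) l := by
    intro l hl
    simp only [Finset.mem_erase, Finset.mem_range] at hl
    rw [map_smul, he.other i k l hi hl.2.2 hl.2.1 hl.1, blockFun, if_neg hl.2.1, if_neg hl.1,
      mul_comm, mul_smul]
  rw [Finset.sum_congr rfl this, ← add_assoc, ← add_assoc, add_left_inj]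
  simp only [blockFun, block, if_true, Nat.succ_ne_self, if_false]
  module

theorem IsBraidFrame.map_letter {u t : Rˣ} (he : IsBraidFrame ρ (ofUnits u t) e) (a : ℕ × Bool)
    (ha : a.1 + 1 < n) (k : ℕ) (c : ℕ → R) :
    ρ (braidLetter n a) (frameVec n e k c) = frameVec n e (strandSwap a.1 k)
      (blockFun ((ofUnits u t).scal k a) ((ofUnits u t).block k a) a.1 c) := by
  obtain ⟨i, b⟩ := a
  cases b with
  | true => exact he.map_pos i k ha c
  | false =>
    have h := he.map_pos i (strandSwap i k) ha
      (blockFun ((ofUnits u t).scal k (i, false)) ((ofUnits u t).block k (i, false)) i c)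
    rw [blockFun_pos_neg, strandSwap_strandSwap] at h
    change ρ (BraidGroup.σ n (i + 1))⁻¹ _ = _
    rw [← h, ← Module.End.mul_apply, ← map_mul, inv_mul_cancel, map_one, Module.End.one_apply]

/-- The action of a word on a frame is computed by `run`, in any `S` to which both the
coordinates over `R` and the entries of the lists over `A` can be mapped. -/
theorem IsBraidFrame.exists_run {A S : Type*} [Zero A] [One A] [Add A] [Sub A] [Mul A] [CommRing S]
    {f : A → S} {g : R →+* S} {P : StrandWeights A} {u t : Rˣ} (hf : Respects f)
    (hP : Matches f g P (ofUnits u t)) (he : IsBraidFrame ρ (ofUnits u t) e)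
    (w : List (ℕ × Bool)) (hw : ∀ a ∈ w, a.1 + 1 < n) (x : ℕ × List A) (c : ℕ → R)
    (hx : ∀ l, f (x.2.getD l 0) = g (c l)) :
    ∃ c' : ℕ → R, ρ (braidWord n w) (frameVec n e x.1 c) = frameVec n e (P.run w x).1 c' ∧
      ∀ l, f ((P.run w x).2.getD l 0) = g (c' l) := by
  induction w with
  | nil => exact ⟨c, by simp [braidWord, run], hx⟩
  | cons a w ih =>
    obtain ⟨c', h1, h2⟩ := ih fun b hb => hw b (List.mem_cons_of_mem _ hb)
    refine ⟨_, ?_, hP.getD_blockList hf (P.run w x).1 a (P.run w x).2 c' h2⟩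
    rw [braidWord_cons, map_mul, Module.End.mul_apply, h1,
      he.map_letter a (hw a List.mem_cons_self)]
    rfl

end Frame

/-! ### Frames in the Burau and the Long-Moody representations -/

section Representations

open StrandWeights BraidGroup

variable {R : Type*} [CommRing R]

/-- The standard basis vector of `R^m` with index `k`, and `0` if `m ≤ k`. -/
def stdVec (R : Type*) [CommRing R] (m k : ℕ) : Fin m → R := fun l => if l.val = k then 1 else 0

/-- The Burau representation is the case `t = 1`, in which the position of the marked strand plays
no role. -/
theorem isBraidFrame_burau (n : ℕ) (u : Rˣ) :
    IsBraidFrame (burau n u) (ofUnits u 1) fun _ l => stdVec R n l := by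
  have key : ∀ i (h : i + 1 < n) v, burau n u (σ n (i + 1)) v =
      blockMap ⟨i, by omega⟩ (burauMatrix u).val v := fun i h v => by
    rw [σ_eq (by omega), burau, MonoidHom.comp_apply, lift_gen]
    rfl
  constructor
  · intro i k h
    rw [key i h]
    funext l
    simp only [blockMap_apply, burauMatrix, stdVec, scal, ofUnits, Matrix.of_apply,
      Matrix.cons_val', Matrix.cons_val_zero, Matrix.cons_val_one, Matrix.cons_val_fin_one,
      Pi.smul_apply, smul_eq_mul, if_true, Units.val_one]
    split_ifs <;> first | omega | ring
  · intro i k h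
    rw [key i h]
    funext l
    simp only [blockMap_apply, burauMatrix, stdVec, scal, wt, ofUnits, Matrix.of_apply,
      Matrix.cons_val', Matrix.cons_val_zero, Matrix.cons_val_one, Matrix.cons_val_fin_one,
      Pi.smul_apply, Pi.add_apply, smul_eq_mul, if_true, Units.val_one]
    split_ifs <;> first | omega | ring
  · intro i k l h hl h1 h2
    rw [key i h]
    funext j
    simp only [blockMap_apply, burauMatrix, stdVec, scal, ofUnits, Matrix.of_apply,
      Matrix.cons_val', Matrix.cons_val_zero, Matrix.cons_val_one, Matrix.cons_val_fin_one,
      Pi.smul_apply, smul_eq_mul, if_true, Units.val_one]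
    split_ifs <;> first | omega | ring

theorem tongYangMa_σ {m i : ℕ} (u : Rˣ) (h : i + 1 < m) (k : ℕ) :
    tongYangMa m u (σ m (i + 1)) (stdVec R m k) =
      (if k = i then (u : R) else 1) • stdVec R m (strandSwap i k) := by
  rw [σ_eq (by omega), tongYangMa, MonoidHom.comp_apply, lift_gen]
  change blockMap _ (tymMatrix u).val _ = _
  funext l
  simp only [blockMap_apply, tymMatrix, stdVec, strandSwap, Matrix.of_apply,
    Matrix.cons_val', Matrix.cons_val_zero, Matrix.cons_val_one, Matrix.cons_val_fin_one,
    Pi.smul_apply, smul_eq_mul]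
  split_ifs <;> first | omega | ring

/-- The braid `σ_j ⋯ σ_1` moves the strands `1, …, j` down by one, without a scalar. The strand `0`,
which moves up to position `j`, is left out. -/
theorem tongYangMa_descend {m j : ℕ} (u : Rˣ) (h : j < m) (k : ℕ) :
    tongYangMa m u (descend m j) (stdVec R m (k + 1)) =
      stdVec R m (if k + 1 ≤ j then k else k + 1) := by
  induction j with
  | zero => simp [descend]
  | succ j ih =>
    rw [descend, map_mul, Module.End.mul_apply, ih (by omega), tongYangMa_σ u h]
    rw [if_neg (by split_ifs <;> omega), one_smul]
    congr 1
    unfold strandSwap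
    split_ifs <;> omega

/-- The pure braid `χ_n(x_{j+1})` winds strand `0` around strand `j + 1`, so that it acts on the
basis vector of that strand by `u` and on the other ones, apart from strand `0`, trivially. -/
theorem tongYangMa_chi {n : ℕ} (u : Rˣ) (j : ℕ) (h : j < n) (k : ℕ) :
    tongYangMa (n + 1) u (chi n (FreeGroup.of ⟨j, h⟩)) (stdVec R (n + 1) (k + 1)) =
      (if j = k then (u : R) else 1) • stdVec R (n + 1) (k + 1) := by
  have hsq : ∀ p, p ≠ j → tongYangMa (n + 1) u (σ (n + 1) (j + 1) ^ 2) (stdVec R (n + 1) p) =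
      (if p = j + 1 then (u : R) else 1) • stdVec R (n + 1) p := fun p hp => by
    rw [pow_two, map_mul, Module.End.mul_apply, tongYangMa_σ u (by omega), map_smul,
      tongYangMa_σ u (by omega), strandSwap_strandSwap, if_neg hp, one_smul]
    congr 1
    unfold strandSwap
    split_ifs <;> first | omega | rfl
  rw [chi_of, mul_assoc, map_mul, map_mul, Module.End.mul_apply, Module.End.mul_apply,
    tongYangMa_descend u (by omega), hsq _ (by split_ifs <;> omega), map_smul,
    ← tongYangMa_descend u (show j < n + 1 by omega), ← Module.End.mul_apply, ← map_mul,
    inv_mul_cancel, map_one, Module.End.one_apply]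
  congr 1
  split_ifs <;> first | omega | rfl

theorem const_σ {A : Type*} [CommGroup A] {m i : ℕ} (u : A) (h : i + 1 < m) :
    const m u (σ m (i + 1)) = u := by
  rw [σ_eq (by omega), const, lift_gen]

theorem const_chi {A : Type*} [CommGroup A] {n : ℕ} (u : A) (j : ℕ) (h : j < n) :
    const (n + 1) u (chi n (FreeGroup.of ⟨j, h⟩)) = u ^ 2 := by
  rw [chi_of, map_mul, map_mul, map_pow, map_inv, const_σ u (by omega)]
  rw [mul_right_comm, inv_mul_cancel, one_mul]

theorem twist_apply {V : Type*} [AddCommGroup V] [Module R V] {n : ℕ} (u : Rˣ)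
    (ρ : Representation R (BraidGroup n) V) (b : BraidGroup n) (v : V) :
    twist u ρ b v = (const n u b : R) • ρ b v := rfl

variable (n : ℕ) (q t : Rˣ)

/-- The representation `τ_1 LM_q(TYM_{n+1})` over any commutative ring with units `q` and `t`. -/
def tauLM : Representation R (BraidGroup n)
    (LongMoodyModule (twist q (tongYangMa (n + 1 + 1) t))) :=
  (twist q⁻¹ (longMoody (twist q (tongYangMa (n + 1 + 1) t)))).comp (shift n)

/-- The vector `(x_{l+2} - 1) ⊗ e_{k+2}` of the Long-Moody module (`0` if `n ≤ l` or `n < k`). -/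
def tauVec (k l : ℕ) : LongMoodyModule (twist q (tongYangMa (n + 1 + 1) t)) :=
  if h : l < n then lmClass _ (FreeGroup.of ⟨l + 1, by omega⟩) (stdVec R (n + 1 + 1) (k + 1)) else 0

theorem twist_tongYangMa_chi (j : ℕ) (h : j < n + 1) (k : ℕ) :
    twist q (tongYangMa (n + 1 + 1) t) (chi (n + 1) (FreeGroup.of ⟨j, h⟩))
      (stdVec R (n + 1 + 1) (k + 1)) =
      (if j = k then (q ^ 2 * t : R) else q ^ 2) • stdVec R (n + 1 + 1) (k + 1) := by
  rw [twist_apply, const_chi, tongYangMa_chi, smul_smul]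
  congr 1
  split_ifs <;> simp

theorem twist_tongYangMa_σ {i : ℕ} (h : i + 1 < n) (k : ℕ) :
    twist q (tongYangMa (n + 1 + 1) t) (σ (n + 1 + 1) (i + 1 + 2)) (stdVec R (n + 1 + 1) (k + 1)) =
      ((q : R) * if k = i + 1 then (t : R) else 1) •
        stdVec R (n + 1 + 1) (strandSwap (i + 1) k + 1) := by
  rw [twist_apply, const_σ q (by omega), tongYangMa_σ t (by omega), smul_smul]
  congr 2
  · simp
  · unfold strandSwap; split_ifs <;> omega

variable {n}

theorem tauLM_σ {i : ℕ} (h : i + 1 < n) (z) : tauLM n q t (σ n (i + 1)) z = ((q⁻¹ : Rˣ) : R) •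
    longMoody (twist q (tongYangMa (n + 1 + 1) t)) (gen ⟨i + 1, by omega⟩) z := by
  have e : shift n (σ n (i + 1)) = σ (n + 1) (i + 1 + 1) := by
    rw [σ_eq (by omega), shift_gen]
  rw [tauLM, MonoidHom.comp_apply, e, twist_apply, const_σ _ (by omega), σ_eq (by omega)]

theorem tauVec_fst {i : ℕ} (h : i + 1 < n) (k : ℕ) :
    tauLM n q t (σ n (i + 1)) (tauVec n q t k i) =
      (if k = i + 1 then (t : R) else 1) • tauVec n q t (strandSwap (i + 1) k) (i + 1) := by
  rw [tauLM_σ q t h, tauVec, tauVec, dif_pos (by omega), dif_pos h]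
  have := longMoody_gen_fst (twist q (tongYangMa (n + 1 + 1) t)) ⟨i + 1, by omega⟩
    (by simp only; omega) (stdVec R (n + 1 + 1) (k + 1))
  rw [twist_tongYangMa_σ n q t h, map_smul] at this
  rw [this, smul_smul, ← mul_assoc, Units.inv_mul, one_mul]

theorem tauVec_snd {i : ℕ} (h : i + 1 < n) (k : ℕ) :
    tauLM n q t (σ n (i + 1)) (tauVec n q t k (i + 1)) =
      (if k = i + 1 then (t : R) else 1) •
        ((if i + 1 + 1 = strandSwap (i + 1) k then (q ^ 2 * t : R) else q ^ 2) •
          tauVec n q t (strandSwap (i + 1) k) i +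
        (1 - if i + 1 = strandSwap (i + 1) k then (q ^ 2 * t : R) else q ^ 2) •
          tauVec n q t (strandSwap (i + 1) k) (i + 1)) := by
  rw [tauLM_σ q t h, tauVec, tauVec, tauVec, dif_pos h, dif_pos h, dif_pos (by omega)]
  have hc := fun j h => twist_tongYangMa_chi n q t j h (strandSwap (i + 1) k)
  have := longMoody_gen_snd (twist q (tongYangMa (n + 1 + 1) t)) ⟨i + 1, by omega⟩
    (by simp only; omega) (stdVec R (n + 1 + 1) (k + 1)) _ _ _ (twist_tongYangMa_σ n q t h k)
    (by rw [map_smul, hc, smul_comm]) (by rw [map_smul, hc, smul_comm])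
  rw [this, map_smul, map_smul, smul_comm _ ((q : R) * _), smul_comm _ ((q : R) * _), ← smul_add,
    smul_smul, ← mul_assoc, Units.inv_mul, one_mul]

theorem tauVec_other {i : ℕ} (h : i + 1 < n) (k l : ℕ) (hl : l < n) (h1 : l ≠ i)
    (h2 : l ≠ i + 1) : tauLM n q t (σ n (i + 1)) (tauVec n q t k l) =
      (if k = i + 1 then (t : R) else 1) • tauVec n q t (strandSwap (i + 1) k) l := by
  rw [tauLM_σ q t h, tauVec, tauVec, dif_pos hl, dif_pos hl, longMoody_gen_other _ _ _
    (by simp only; omega) (by simp only; omega)]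
  change ((q⁻¹ : Rˣ) : R) • lmClass _ _ (twist q (tongYangMa (n + 1 + 1) t)
    (σ (n + 1 + 1) (i + 1 + 2)) _) = _
  rw [twist_tongYangMa_σ n q t h, map_smul, smul_smul, ← mul_assoc, Units.inv_mul, one_mul]

variable (n)

/-- The vectors `(x_l - 1) ⊗ e_k` with `k ≥ 3` and `l ≥ 2` form a frame in which strand `k` is
marked. -/
theorem isBraidFrame_tauLM :
    IsBraidFrame (tauLM n q t) (ofUnits (q ^ 2) t) fun k l => tauVec n q t (k + 1) l := by
  have hs : ∀ i k, strandSwap (i + 1) (k + 1) = strandSwap i k + 1 := fun i k => by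
    unfold strandSwap; split_ifs <;> omega
  constructor
  · intro i k h
    simp only [tauVec_fst q t h, hs, scal, ofUnits, add_left_inj, if_true]
  · intro i k h
    simp only [tauVec_snd q t h, hs, scal, wt, ofUnits, add_left_inj, if_true,
      Units.val_pow_eq_pow_val]
  · intro i k l h hl h1 h2
    simp only [tauVec_other q t h _ l hl h1 h2, hs, scal, ofUnits, add_left_inj, if_true]

/-- The span of `(x_l - 1) ⊗ e_2` with `l ≥ 2` is a Burau representation, since `e_2` is fixed and
all `x_l` with `l ≥ 2` act on it by `q²`. -/
theorem isBraidFrame_tauLM_burau :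
    IsBraidFrame (tauLM n q t) (ofUnits (q ^ 2) 1) fun _ l => tauVec n q t 0 l := by
  have hs : ∀ i, strandSwap (i + 1) 0 = 0 := fun i => by
    unfold strandSwap; split_ifs <;> omega
  constructor
  · intro i k h
    simp [tauVec_fst q t h, hs, scal, ofUnits]
  · intro i k h
    simp [tauVec_snd q t h, hs, scal, wt, ofUnits]
  · intro i k l h hl h1 h2
    simp [tauVec_other q t h _ l hl h1 h2, hs, scal, ofUnits]

/-- The coefficient of `(x_{l+2} - 1) ⊗ e_{k+2}`. -/
def tauCoord (k l : ℕ) (hk : k < n + 1) (hl : l < n) :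
    LongMoodyModule (twist q (tongYangMa (n + 1 + 1) t)) →ₗ[R] R :=
  LinearMap.proj (R := R) (φ := fun _ : Fin (n + 1 + 1) => R) ⟨k + 1, by omega⟩ ∘ₗ
    lmCoord _ ⟨l + 1, by omega⟩

theorem tauCoord_sum (k l : ℕ) (hk : k < n + 1) (hl : l < n) (c : ℕ → R) :
    tauCoord n q t k l hk hl (∑ j ∈ Finset.range n, c j • tauVec n q t k j) = c l := by
  rw [map_sum, Finset.sum_eq_single_of_mem l (Finset.mem_range.2 hl)]
  · rw [map_smul, tauVec, dif_pos hl, tauCoord, LinearMap.comp_apply, lmCoord_lmClass]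
    simp [stdVec]
  · intro j hj hjl
    rw [map_smul, tauVec, dif_pos (Finset.mem_range.1 hj), tauCoord, LinearMap.comp_apply,
      lmCoord_lmClass]
    simp [hjl]

end Representations

/-! ### Computable Laurent polynomials -/

/-- An integral Laurent polynomial: the exponent of the lowest term and the list of coefficients.
The encoding is not unique. -/
structure LaurentList where
  /-- The lowest exponent. -/
  low : ℤ
  /-- The coefficients, by increasing exponent. -/
  coeffs : List ℤ

namespace LaurentList

/-- Addition of coefficient lists. -/
def addCoeffs : List ℤ → List ℤ → List ℤ
  | [], m => m
  | a :: l, [] => a :: l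
  | a :: l, b :: m => (a + b) :: addCoeffs l m

/-- Multiplication of a coefficient list by an integer. -/
def scale (a : ℤ) (m : List ℤ) : List ℤ := if a = 1 then m else m.map (a * ·)

/-- Multiplication of coefficient lists. -/
def mulCoeffs : List ℤ → List ℤ → List ℤ
  | [], _ => []
  | [a], m => scale a m
  | a :: b :: l, m => addCoeffs (scale a m) (0 :: mulCoeffs (b :: l) m)

/-- Multiplication of a coefficient list by a power of the variable. -/
def pad : ℕ → List ℤ → List ℤ
  | 0, l => l
  | n + 1, l => 0 :: pad n l

instance : Zero LaurentList := ⟨⟨0, []⟩⟩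
instance : One LaurentList := ⟨⟨0, [1]⟩⟩
instance : Mul LaurentList := ⟨fun x y => ⟨x.low + y.low, mulCoeffs x.coeffs y.coeffs⟩⟩
instance : Add LaurentList := ⟨fun x y =>
  if x.low ≤ y.low then ⟨x.low, addCoeffs x.coeffs (pad (y.low - x.low).toNat y.coeffs)⟩
  else ⟨y.low, addCoeffs (pad (x.low - y.low).toNat x.coeffs) y.coeffs⟩⟩
instance : Neg LaurentList := ⟨fun x => ⟨x.low, scale (-1) x.coeffs⟩⟩
instance : Sub LaurentList := ⟨fun x y => x + -y⟩

theorem zero_def : (0 : LaurentList) = ⟨0, []⟩ := rfl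
theorem one_def : (1 : LaurentList) = ⟨0, [1]⟩ := rfl
theorem mul_def (x y : LaurentList) :
    x * y = ⟨x.low + y.low, mulCoeffs x.coeffs y.coeffs⟩ := rfl
theorem add_def (x y : LaurentList) : x + y =
  if x.low ≤ y.low then ⟨x.low, addCoeffs x.coeffs (pad (y.low - x.low).toNat y.coeffs)⟩
  else ⟨y.low, addCoeffs (pad (x.low - y.low).toNat x.coeffs) y.coeffs⟩ := rfl
theorem neg_def (x : LaurentList) : -x = ⟨x.low, scale (-1) x.coeffs⟩ := rfl
theorem sub_def (x y : LaurentList) : x - y = x + -y := rfl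

section Eval

variable {R : Type*} [CommRing R] (u : Rˣ)

/-- The value at `u` of the polynomial with the given coefficients. -/
def evalCoeffs : List ℤ → R
  | [] => 0
  | a :: l => a + u * evalCoeffs l

/-- The value at the unit `u`. -/
def eval (x : LaurentList) : R := ((u ^ x.low : Rˣ) : R) * evalCoeffs u x.coeffs

theorem evalCoeffs_add (l m : List ℤ) :
    evalCoeffs u (addCoeffs l m) = evalCoeffs u l + evalCoeffs u m := by
  induction l generalizing m with
  | nil => simp [addCoeffs, evalCoeffs]
  | cons a l ih =>
    cases m with
    | nil => simp [addCoeffs, evalCoeffs]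
    | cons b m => simp only [addCoeffs, evalCoeffs, ih]; push_cast; ring

theorem evalCoeffs_scale (a : ℤ) (m : List ℤ) :
    evalCoeffs u (scale a m) = a * evalCoeffs u m := by
  unfold scale
  split_ifs with h
  · simp [h]
  · induction m with
    | nil => simp [evalCoeffs]
    | cons b m ih => simp only [List.map_cons, evalCoeffs, ih]; push_cast; ring

theorem evalCoeffs_mul (l m : List ℤ) :
    evalCoeffs u (mulCoeffs l m) = evalCoeffs u l * evalCoeffs u m := by
  induction l with
  | nil => simp [mulCoeffs, evalCoeffs]
  | cons a l ih =>
    cases l with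
    | nil => simp [mulCoeffs, evalCoeffs, evalCoeffs_scale]
    | cons b l =>
      rw [mulCoeffs, evalCoeffs_add, evalCoeffs_scale, evalCoeffs, ih, evalCoeffs.eq_2 u a]
      push_cast
      ring

theorem evalCoeffs_pad (n : ℕ) (l : List ℤ) :
    evalCoeffs u (pad n l) = ((u ^ n : Rˣ) : R) * evalCoeffs u l := by
  induction n with
  | zero => simp [pad]
  | succ n ih => simp only [pad, evalCoeffs, ih]; push_cast; ring

theorem eval_pad {a b : ℤ} (h : a ≤ b) (l : List ℤ) :
    eval u ⟨a, pad (b - a).toNat l⟩ = eval u ⟨b, l⟩ := by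
  have e : u ^ b = u ^ a * u ^ (b - a).toNat := by
    rw [← zpow_natCast, ← zpow_add, Int.toNat_of_nonneg (by omega)]
    congr 1
    omega
  simp only [eval, evalCoeffs_pad, e, Units.val_mul, mul_assoc]

theorem eval_add (x y : LaurentList) : eval u (x + y) = eval u x + eval u y := by
  have h : ∀ a l m, eval u ⟨a, addCoeffs l m⟩ = eval u ⟨a, l⟩ + eval u ⟨a, m⟩ := fun a l m => by
    simp only [eval, evalCoeffs_add, mul_add]
  rw [add_def]
  split_ifs with hxy
  · rw [h, eval_pad u hxy]
  · rw [h, eval_pad u (by omega)]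

theorem eval_neg (x : LaurentList) : eval u (-x) = -eval u x := by
  simp [neg_def, eval, evalCoeffs_scale]

theorem respects_eval : StrandWeights.Respects (eval u) where
  map_zero := by simp [zero_def, eval, evalCoeffs]
  map_one := by simp [one_def, eval, evalCoeffs]
  map_add := eval_add u
  map_sub x y := by rw [sub_def, eval_add, eval_neg, sub_eq_add_neg]
  map_mul x y := by
    simp only [mul_def, eval, evalCoeffs_mul, zpow_add, Units.val_mul]
    ring

/-- A sufficient test for two encodings to have the same value. -/
def sameValue (x y : LaurentList) : Bool := (x - y).coeffs.all (· == 0)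

theorem eval_eq_of_sameValue {x y : LaurentList} (h : sameValue x y = true) :
    eval u x = eval u y := by
  have h0 : ∀ l : List ℤ, l.all (· == 0) = true → evalCoeffs u l = 0 := fun l hl => by
    induction l with
    | nil => rfl
    | cons a l ih =>
      simp only [List.all_cons, Bool.and_eq_true, beq_iff_eq] at hl
      simp [evalCoeffs, hl.1, ih hl.2]
  rw [← sub_eq_zero, ← (respects_eval u).map_sub, eval, h0 _ h, mul_zero]

/-- The entrywise version of `sameValue`. -/
def sameValues : List LaurentList → List LaurentList → Bool
  | [], [] => true
  | x :: l, y :: m => sameValue x y && sameValues l m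
  | _, _ => false

theorem eval_getD_of_sameValues {L M : List LaurentList} (h : sameValues L M = true) (j : ℕ) :
    eval u (L.getD j 0) = eval u (M.getD j 0) := by
  induction L generalizing M j with
  | nil => cases M with
    | nil => rfl
    | cons y m => simp [sameValues] at h
  | cons x l ih => cases M with
    | nil => simp [sameValues] at h
    | cons y m =>
      simp only [sameValues, Bool.and_eq_true] at h
      cases j with
      | zero => exact eval_eq_of_sameValue u h.1
      | succ j => exact ih h.2 j

end Eval

end LaurentList

/-! ### Tests for commutators -/

section Tests

open StrandWeights BraidGroup

theorem comm_mem_ker_iff {G H : Type*} [Group G] [Monoid H] (f : G →* H) (a b : G) :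
    BraidGroup.comm a b ∈ f.ker ↔ f (a * b) = f (b * a) := by
  have e : BraidGroup.comm a b = (b * a)⁻¹ * (a * b) := by unfold BraidGroup.comm; group
  rw [MonoidHom.mem_ker, e, map_mul]
  constructor
  · intro h
    calc f (a * b) = f (b * a) * (f (b * a)⁻¹ * f (a * b)) := by
          rw [← mul_assoc, ← map_mul, mul_inv_cancel, map_one, one_mul]
      _ = f (b * a) := by rw [h, mul_one]
  · intro h
    rw [h, ← map_mul, inv_mul_cancel, map_one]

/-- The parameters `u` and `t = 1` of the Burau representation, with `u` the variable. -/
def burauWeights : StrandWeights LaurentList := ⟨⟨1, [1]⟩, ⟨-1, [1]⟩, 1, 1⟩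

/-- Do two words act in the same way on the first `m` basis vectors of the Burau
representation? -/
def burauTest (m : ℕ) (v w : List (ℕ × Bool)) : Bool :=
  (List.range m).all fun l => LaurentList.sameValues
    (burauWeights.run v (0, unitList _ l)).2 (burauWeights.run w (0, unitList _ l)).2

theorem frameVec_ite {R M : Type*} [CommRing R] [AddCommGroup M] [Module R M] {n l : ℕ}
    (h : l < n) (e : ℕ → ℕ → M) (k : ℕ) :
    frameVec n e k (fun j => if j = l then (1 : R) else 0) = e k l := by
  unfold frameVec
  rw [Finset.sum_eq_single_of_mem l (Finset.mem_range.2 h)]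
  · simp
  · intro j _ hj
    simp [hj]

variable {R : Type*} [CommRing R]

/-- A word in `σ_1, …, σ_{m-1}` fixes the remaining basis vectors. -/
theorem burau_braidWord_stdVec {n m : ℕ} (u : Rˣ) (w : List (ℕ × Bool))
    (hw : ∀ a ∈ w, a.1 + 1 < m) {l : ℕ} (hl : l < n) (hml : m ≤ l) :
    burau n u (braidWord n w) (stdVec R n l) = stdVec R n l := by
  induction w with
  | nil => simp [braidWord]
  | cons a w ih =>
    rw [braidWord_cons, map_mul, Module.End.mul_apply,
      ih fun b hb => hw b (List.mem_cons_of_mem _ hb)]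
    have ha := hw a List.mem_cons_self
    have h : burau n u (σ n (a.1 + 1)) (stdVec R n l) = stdVec R n l := by
      rw [(isBraidFrame_burau n u).other a.1 0 l (by omega) hl (by omega) (by omega)]
      simp [scal, ofUnits]
    unfold braidLetter
    split_ifs
    · exact h
    · nth_rewrite 1 [← h]
      rw [← Module.End.mul_apply, ← map_mul, inv_mul_cancel, map_one, Module.End.one_apply]

theorem burau_eq_of_burauTest {n m : ℕ} (hmn : m ≤ n) (u : Rˣ) {v w : List (ℕ × Bool)}
    (hv : ∀ a ∈ v, a.1 + 1 < m) (hw : ∀ a ∈ w, a.1 + 1 < m) (h : burauTest m v w = true) :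
    burau n u (braidWord n v) = burau n u (braidWord n w) := by
  have key : ∀ l < n, burau n u (braidWord n v) (stdVec R n l) =
      burau n u (braidWord n w) (stdVec R n l) := by
    intro l hl
    rcases Nat.lt_or_ge l m with hlm | hlm
    swap
    · rw [burau_braidWord_stdVec u v hv hl hlm, burau_braidWord_stdVec u w hw hl hlm]
    have hf := LaurentList.respects_eval u
    have hP : Matches (LaurentList.eval u) (RingHom.id R) burauWeights (ofUnits u 1) := by
      constructor <;>
        simp [burauWeights, ofUnits, LaurentList.eval, LaurentList.evalCoeffs, LaurentList.one_def]
    have he := isBraidFrame_burau n u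
    have hx : ∀ j, LaurentList.eval u ((unitList LaurentList l).getD j 0) =
        RingHom.id R (if j = l then 1 else 0) := fun j => by
      rw [unitList_getD]
      split_ifs
      · exact hf.map_one
      · exact hf.map_zero
    obtain ⟨c, hc, hc'⟩ := he.exists_run hf hP v (fun a ha => (hv a ha).trans_le hmn)
      (0, unitList _ l) _ hx
    obtain ⟨d, hd, hd'⟩ := he.exists_run hf hP w (fun a ha => (hw a ha).trans_le hmn)
      (0, unitList _ l) _ hx
    rw [frameVec_ite hl] at hc hd
    rw [hc, hd]
    refine Finset.sum_congr rfl fun j _ => ?_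
    have := LaurentList.eval_getD_of_sameValues u
      (List.all_eq_true.1 h l (List.mem_range.2 hlm)) j
    rw [hc' j, hd' j] at this
    exact congrArg (· • stdVec R n j) this
  refine LinearMap.pi_ext' fun l => LinearMap.ext_ring ?_
  have hs : stdVec R n l.val = LinearMap.single R (fun _ : Fin n => R) l 1 := by
    funext j
    simp [stdVec, Pi.single_apply, Fin.ext_iff]
  have := key l.val l.isLt
  rw [hs] at this
  exact this

/-- The unit `2` of `ZMod 5`, the value of `q`. -/
def unitTwo : (ZMod 5)ˣ := ⟨2, 3, by decide, by decide⟩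

/-- The ring homomorphism `ℤ[t^{±1}, q^{±1}] → ZMod 5` with `q ↦ 2` and `t ↦ -1`. -/
def specialize : LaurentTQ →+* ZMod 5 :=
  LaurentPolynomial.eval₂ (LaurentPolynomial.eval₂ (Int.castRingHom _) (-1)) unitTwo

theorem map_specialize_varQ : Units.map specialize.toMonoidHom varQ = unitTwo := by
  refine Units.ext ?_
  change specialize (LaurentPolynomial.T 1) = _
  simp [specialize]

theorem map_specialize_varT : Units.map specialize.toMonoidHom varT = -1 := by
  refine Units.ext ?_
  change specialize (LaurentPolynomial.C (LaurentPolynomial.T 1)) = _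
  simp [specialize]

/-- The parameters `u = q² = 4` and `t = -1` in `ZMod 5`; both are their own inverses. -/
def modFiveWeights : StrandWeights (ZMod 5) := ⟨4, 4, 4, 4⟩

theorem matches_specialize :
    Matches id specialize modFiveWeights (ofUnits (varQ ^ 2) varT) := by
  have hu : Units.map specialize.toMonoidHom (varQ ^ 2) = unitTwo ^ 2 := by
    rw [map_pow, map_specialize_varQ]
  have hu' : Units.map specialize.toMonoidHom (varQ ^ 2)⁻¹ = (unitTwo ^ 2)⁻¹ := by
    rw [map_inv, hu]
  have ht' : Units.map specialize.toMonoidHom varT⁻¹ = (-1)⁻¹ := by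
    rw [map_inv, map_specialize_varT]
  exact
    { u := (congrArg Units.val hu).symm
      u' := (congrArg Units.val hu').symm
      t := (congrArg Units.val map_specialize_varT).symm
      t' := (congrArg Units.val ht').symm }

/-- Do the images of the basis vector with index `l` and marked strand `k` under two words differ
in coordinate `j`, the marked strand having the same final position? -/
def ModFiveDiffer (v w : List (ℕ × Bool)) (k l j : ℕ) : Prop :=
  (modFiveWeights.run v (k, unitList _ l)).1 = (modFiveWeights.run w (k, unitList _ l)).1 ∧
  (modFiveWeights.run v (k, unitList _ l)).2.getD j 0 ≠
    (modFiveWeights.run w (k, unitList _ l)).2.getD j 0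

instance (v w : List (ℕ × Bool)) (k l j : ℕ) : Decidable (ModFiveDiffer v w k l j) :=
  inferInstanceAs (Decidable (_ ∧ _))

theorem strandSwap_lt {i k n : ℕ} (hi : i + 1 < n) (hk : k < n) : strandSwap i k < n := by
  unfold strandSwap; split_ifs <;> omega

theorem run_fst_lt {A : Type*} [Zero A] [One A] [Add A] [Sub A] [Mul A] (P : StrandWeights A)
    {n : ℕ} (w : List (ℕ × Bool)) (hw : ∀ a ∈ w, a.1 + 1 < n) (x : ℕ × List A) (hx : x.1 < n) :
    (P.run w x).1 < n := by
  induction w with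
  | nil => exact hx
  | cons a w ih =>
    exact strandSwap_lt (hw a List.mem_cons_self) (ih fun b hb => hw b (List.mem_cons_of_mem _ hb))

/-- The coordinates of the two images differ already after the specialization to `ZMod 5`. -/
theorem tauLM_ne_of_modFiveDiffer {n k l j : ℕ} {v w : List (ℕ × Bool)}
    (hv : ∀ a ∈ v, a.1 + 1 < n) (hw : ∀ a ∈ w, a.1 + 1 < n) (hk : k < n) (hj : j < n)
    (h : ModFiveDiffer v w k l j) :
    tauLMqTYM n (braidWord n v) ≠ tauLMqTYM n (braidWord n w) := by
  intro heq
  have hf : Respects (id : ZMod 5 → ZMod 5) := ⟨rfl, rfl, fun _ _ => rfl, fun _ _ => rfl,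
    fun _ _ => rfl⟩
  have he := isBraidFrame_tauLM n varQ varT
  have hx : ∀ i, id ((unitList (ZMod 5) l).getD i 0) = specialize (if i = l then 1 else 0) :=
    fun i => by rw [id, unitList_getD]; split_ifs <;> simp
  obtain ⟨c, hc, hc'⟩ := he.exists_run hf matches_specialize v hv (k, unitList _ l) _ hx
  obtain ⟨d, hd, hd'⟩ := he.exists_run hf matches_specialize w hw (k, unitList _ l) _ hx
  have hlt := run_fst_lt modFiveWeights v hv (k, unitList _ l) hk
  change tauLMqTYM n (braidWord n v) _ = _ at hc
  change tauLMqTYM n (braidWord n w) _ = _ at hd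
  rw [heq, hd, ← h.1] at hc
  have hcd := congrArg (tauCoord n varQ varT _ j (Nat.succ_lt_succ hlt) hj) hc
  unfold frameVec at hcd
  rw [tauCoord_sum, tauCoord_sum] at hcd
  exact h.2 (by rw [← id_eq (List.getD _ _ _), hc', ← hcd, ← hd', id])

end Tests

/-! ### The inclusion of the kernels -/

section Inclusion

open StrandWeights BraidGroup

variable {R : Type*} [CommRing R] (n : ℕ) (q t : Rˣ)

/-- The embedding of the Burau representation with parameter `q²` into `τ_1 LM_q(TYM_{n+1})` that
sends the basis vector with index `l` to `tauVec n q t 0 l`. -/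
def burauEmbed : (Fin n → R) →ₗ[R] LongMoodyModule (twist q (tongYangMa (n + 1 + 1) t)) :=
  ∑ l : Fin n, (LinearMap.proj l).smulRight (tauVec n q t 0 l.val)

theorem burauEmbed_apply (c : ℕ → R) :
    burauEmbed n q t (fun l => c l.val) = frameVec n (fun _ l => tauVec n q t 0 l) 0 c := by
  simp only [burauEmbed, LinearMap.sum_apply, LinearMap.smulRight_apply, LinearMap.proj_apply,
    frameVec]
  exact Fin.sum_univ_eq_sum_range (fun l => c l • tauVec n q t 0 l) n

theorem frameVec_stdVec (c : ℕ → R) :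
    frameVec n (fun _ l => stdVec R n l) 0 c = fun l => c l.val := by
  funext j
  simp [frameVec, stdVec, Finset.sum_apply]

theorem exists_eq_comp_val {A : Type*} [Zero A] (v : Fin n → A) :
    ∃ c : ℕ → A, v = fun l => c l.val :=
  ⟨fun l => if h : l < n then v ⟨l, h⟩ else 0, by funext l; simp⟩

theorem burauEmbed_injective : Function.Injective (burauEmbed n q t) := by
  intro v w h
  obtain ⟨c, rfl⟩ := exists_eq_comp_val n v
  obtain ⟨d, rfl⟩ := exists_eq_comp_val n w
  rw [burauEmbed_apply, burauEmbed_apply] at h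
  funext l
  have := congrArg (tauCoord n q t 0 l.val (by omega) l.isLt) h
  unfold frameVec at this
  rwa [tauCoord_sum, tauCoord_sum] at this

theorem tauLM_burauEmbed (b : BraidGroup n) (v : Fin n → R) :
    tauLM n q t b (burauEmbed n q t v) = burauEmbed n q t (burau n (q ^ 2) b v) := by
  induction b using induction_gen generalizing v with
  | hg i =>
    have hi : i.val + 1 < n := by omega
    have e : (gen i : BraidGroup n) = σ n (i.val + 1) := (σ_eq i.isLt).symm
    obtain ⟨c, rfl⟩ := exists_eq_comp_val n v
    have h1 := (isBraidFrame_tauLM_burau n q t).map_pos i.val 0 hi c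
    have h2 := (isBraidFrame_burau n (q ^ 2)).map_pos i.val 0 hi c
    rw [frameVec_stdVec] at h2
    rw [e, burauEmbed_apply, h1, h2]
    exact ((congrArg _ (frameVec_stdVec n _)).trans (burauEmbed_apply n q t _)).symm
  | h1 => simp
  | hm a b ha hb => simp only [map_mul, Module.End.mul_apply, ha, hb]
  | hi a ha =>
    have := ha (burau n (q ^ 2) a⁻¹ v)
    rw [← Module.End.mul_apply, ← map_mul, mul_inv_cancel, map_one, Module.End.one_apply] at this
    rw [← this, ← Module.End.mul_apply, ← map_mul, inv_mul_cancel, map_one, Module.End.one_apply]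

theorem ker_tauLM_le_ker_burau : (tauLM n q t).ker ≤ (burau n (q ^ 2)).ker := by
  intro b hb
  rw [MonoidHom.mem_ker] at hb ⊢
  refine LinearMap.ext fun v => burauEmbed_injective n q t ?_
  rw [← tauLM_burauEmbed, hb, Module.End.one_apply, Module.End.one_apply]

end Inclusion

/-! ### The four commutators as words -/

section Words

open StrandWeights BraidGroup

/-- The word with the letters `σ_i` for the entries `i > 0` and `σ_i⁻¹` for the entries `-i < 0`. -/
def intWord (L : List ℤ) : List (ℕ × Bool) := L.map fun x => (x.natAbs - 1, decide (0 < x))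

theorem comm_mem_ker_burau {R : Type*} [CommRing R] {n m : ℕ} (hmn : m ≤ n) (u : Rˣ)
    {v w : List (ℕ × Bool)} (h : ∀ a ∈ v ++ w, a.1 + 1 < m)
    (ht : burauTest m (v ++ w) (w ++ v) = true) :
    BraidGroup.comm (braidWord n v) (braidWord n w) ∈ (burau n u).ker := by
  rw [comm_mem_ker_iff, ← braidWord_append, ← braidWord_append]
  exact burau_eq_of_burauTest hmn u h (fun a ha => h a (by simpa [or_comm] using ha)) ht

theorem comm_notMem_ker_tauLMqTYM {n m k l j : ℕ} (hmn : m ≤ n) {v w : List (ℕ × Bool)}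
    (h : ∀ a ∈ v ++ w, a.1 + 1 < m) (hk : k < m) (hj : j < m)
    (ht : ModFiveDiffer (v ++ w) (w ++ v) k l j) :
    BraidGroup.comm (braidWord n v) (braidWord n w) ∉ (tauLMqTYM n).ker := by
  rw [comm_mem_ker_iff, ← braidWord_append, ← braidWord_append]
  have h' : ∀ a ∈ v ++ w, a.1 + 1 < n := fun a ha => (h a ha).trans_le hmn
  exact tauLM_ne_of_modFiveDiffer h' (fun a ha => h' a (by simpa [or_comm] using ha))
    (hk.trans_le hmn) (hj.trans_le hmn) ht

/-- The conjugate `ψ₁⁻¹ σ_4 ψ₁`. -/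
def sigmaLeft : List (ℕ × Bool) :=
  intWord [-2, -3, -4, -4, -4, -2, -1, -1, -2, 3, 4, -3, 2, 1, 1, 2, 4, 4, 4, 3, 2]

/-- The conjugate by `ψ₂` in the commutator `σ`. -/
def sigmaRight : List (ℕ × Bool) :=
  intWord [-4, -4, -4, -4, -4, -1, -2, -2, -1, -1, -2, 1, 1, -2, -3, 4, 4, 3, 2, 1, 1, 2, 3, 4,
    -4, 3, 2, -1, -1, 2, 1, 1, 2, 2, 1, 4, 4, 4, 4, 4]

/-- The conjugate `δ₁⁻¹ σ_3 δ₁`. -/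
def tauLeft : List (ℕ × Bool) := intWord [-1, 2, 5, -4, 3, 4, -5, -2, 1]

/-- The conjugate `δ₂⁻¹ σ_3 δ₂`. -/
def tauRight : List (ℕ × Bool) := intWord [1, 1, -2, -5, -5, 4, 3, -4, 5, 5, 2, -1, -1]

/-- The conjugate `θ⁻¹ σ_5 θ`. -/
def xiLeft : List (ℕ × Bool) :=
  intWord [-1, 2, 3, -4, -5, -1, -1, -1, 3, 3, 3, 2, -4, 3, -5, 4, 5, 5, -5, -4, 5, -3, 4, -2, -3,
    -3, -3, 1, 1, 1, 5, 4, -3, -2, 1]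

/-- The power `(σ_2 σ_3 σ_4 σ_5)⁵`. -/
def xiRight : List (ℕ × Bool) :=
  intWord [2, 3, 4, 5, 2, 3, 4, 5, 2, 3, 4, 5, 2, 3, 4, 5, 2, 3, 4, 5]

/-- The generator `σ_1`. -/
def nuLeft : List (ℕ × Bool) := intWord [1]

/-- The conjugate of `σ_6` by the shift of `θ`. -/
def nuRight : List (ℕ × Bool) :=
  intWord [-2, 3, 4, -5, -6, -2, -2, -2, 4, 4, 4, 3, -5, 4, -6, 5, 6, 6, -6, -5, 6, -4, 5, -3, -4,
    -4, -4, 2, 2, 2, 6, 5, -4, -3, 2]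

theorem sigma5_eq : sigma5 = BraidGroup.comm (braidWord 5 sigmaLeft) (braidWord 5 sigmaRight) := by
  simp [sigma5, sigmaLeft, sigmaRight, intWord, braidWord, braidLetter, pow_succ, mul_assoc]

theorem tau6_eq : tau6 = BraidGroup.comm (braidWord 6 tauLeft) (braidWord 6 tauRight) := by
  simp [tau6, tauLeft, tauRight, intWord, braidWord, braidLetter, pow_succ, mul_assoc]

theorem xi6_eq : xi6 = BraidGroup.comm (braidWord 6 xiLeft) (braidWord 6 xiRight) := by
  simp [xi6, theta6, xiLeft, xiRight, intWord, braidWord, braidLetter, pow_succ, mul_assoc]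

theorem nu7_eq : nu7 = BraidGroup.comm (braidWord 7 nuLeft) (braidWord 7 nuRight) := by
  have hs : ∀ i, i + 1 < 6 → shift 6 (σ 6 (i + 1)) = σ 7 (i + 2) := fun i hi => by
    rw [σ_eq (by omega), shift_gen]
  have h1 := hs 0 (by omega)
  have h2 := hs 1 (by omega)
  have h3 := hs 2 (by omega)
  have h4 := hs 3 (by omega)
  have h5 := hs 4 (by omega)
  norm_num at h1 h2 h3 h4 h5
  simp [nu7, theta6, nuLeft, nuRight, intWord, braidWord, braidLetter, pow_succ, mul_assoc,
    h1, h2, h3, h4, h5]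

set_option maxRecDepth 10000

theorem sigma_letters : ∀ a ∈ sigmaLeft ++ sigmaRight, a.1 + 1 < 5 := by decide

theorem sigma_burauTest :
    burauTest 5 (sigmaLeft ++ sigmaRight) (sigmaRight ++ sigmaLeft) = true := by
  decide +kernel

theorem sigma_modFive :
    ModFiveDiffer (sigmaLeft ++ sigmaRight) (sigmaRight ++ sigmaLeft) 1 0 0 := by
  decide +kernel

theorem tau_letters : ∀ a ∈ tauLeft ++ tauRight, a.1 + 1 < 6 := by decide

theorem tau_burauTest : burauTest 6 (tauLeft ++ tauRight) (tauRight ++ tauLeft) = true := by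
  decide +kernel

theorem tau_modFive : ModFiveDiffer (tauLeft ++ tauRight) (tauRight ++ tauLeft) 0 1 0 := by
  decide +kernel

theorem xi_letters : ∀ a ∈ xiLeft ++ xiRight, a.1 + 1 < 6 := by decide

theorem xi_burauTest : burauTest 6 (xiLeft ++ xiRight) (xiRight ++ xiLeft) = true := by
  decide +kernel

theorem xi_modFive : ModFiveDiffer (xiLeft ++ xiRight) (xiRight ++ xiLeft) 0 1 0 := by
  decide +kernel

theorem nu_letters : ∀ a ∈ nuLeft ++ nuRight, a.1 + 1 < 7 := by decide

theorem nu_burauTest : burauTest 7 (nuLeft ++ nuRight) (nuRight ++ nuLeft) = true := by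
  decide +kernel

theorem nu_modFive : ModFiveDiffer (nuLeft ++ nuRight) (nuRight ++ nuLeft) 0 2 1 := by
  decide +kernel

end Words

theorem corollary5p4 :
    (∀ n : ℕ, 3 ≤ n →
      MonoidHom.ker (tauLMqTYM n) ≤ MonoidHom.ker (burau n (varQ ^ 2))) ∧
    (∀ n : ℕ, 5 ≤ n →
      MonoidHom.ker (tauLMqTYM n) < MonoidHom.ker (burau n (varQ ^ 2))) ∧
    (BraidGroup.sigma5 ≠ 1 ∧
      BraidGroup.sigma5 ∈ MonoidHom.ker (burau 5 (varQ ^ 2)) ∧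
      BraidGroup.sigma5 ∉ MonoidHom.ker (tauLMqTYM 5)) ∧
    (BraidGroup.tau6 ≠ 1 ∧
      BraidGroup.tau6 ∈ MonoidHom.ker (burau 6 (varQ ^ 2)) ∧
      BraidGroup.tau6 ∉ MonoidHom.ker (tauLMqTYM 6)) ∧
    (BraidGroup.xi6 ≠ 1 ∧
      BraidGroup.xi6 ∈ MonoidHom.ker (burau 6 (varQ ^ 2)) ∧
      BraidGroup.xi6 ∉ MonoidHom.ker (tauLMqTYM 6)) ∧
    (BraidGroup.nu7 ≠ 1 ∧
      BraidGroup.nu7 ∈ MonoidHom.ker (burau 7 (varQ ^ 2)) ∧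
      BraidGroup.nu7 ∉ MonoidHom.ker (tauLMqTYM 7)) := by
  have hle : ∀ n, MonoidHom.ker (tauLMqTYM n) ≤ MonoidHom.ker (burau n (varQ ^ 2)) := fun n =>
    ker_tauLM_le_ker_burau n varQ varT
  have ne_one : ∀ {n} {b : BraidGroup n}, b ∉ MonoidHom.ker (tauLMqTYM n) → b ≠ 1 := by
    rintro n b h rfl
    exact h (one_mem _)
  have hσ := fun n (hn : 5 ≤ n) => comm_mem_ker_burau hn (varQ ^ 2) sigma_letters sigma_burauTest
  have hσ' := fun n (hn : 5 ≤ n) => comm_notMem_ker_tauLMqTYM hn sigma_letters (by decide)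
    (by decide) sigma_modFive
  have hτ' := comm_notMem_ker_tauLMqTYM le_rfl tau_letters (by decide) (by decide) tau_modFive
  have hξ' := comm_notMem_ker_tauLMqTYM le_rfl xi_letters (by decide) (by decide) xi_modFive
  have hν' := comm_notMem_ker_tauLMqTYM le_rfl nu_letters (by decide) (by decide) nu_modFive
  rw [sigma5_eq, tau6_eq, xi6_eq, nu7_eq]
  exact ⟨fun n _ => hle n,
    fun n hn => (hle n).lt_of_not_ge fun h => hσ' n hn (h (hσ n hn)),
    ⟨ne_one (hσ' 5 le_rfl), hσ 5 le_rfl, hσ' 5 le_rfl⟩,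
    ⟨ne_one hτ', comm_mem_ker_burau le_rfl _ tau_letters tau_burauTest, hτ'⟩,
    ⟨ne_one hξ', comm_mem_ker_burau le_rfl _ xi_letters xi_burauTest, hξ'⟩,
    ⟨ne_one hν', comm_mem_ker_burau le_rfl _ nu_letters nu_burauTest, hν'⟩⟩

end
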